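/- Let $d \ge 2$ and let $\Gamma$ be a finite alphabet. Let $Y \subset \Gamma^{\mathbb{Z}^d}$ be a shift space (a closed shift-invariant set) that is vertically constant, i.e. the basis vectors $\vec e_2, \dots, \vec e_d$ are periods of every configuration of $Y$. Suppose that $Y$ is a sofic shift with a countable SFT cover: there are a finite alphabet $\Sigma$, a shift of finite type $X \subset \Sigma^{\mathbb{Z}^d}$ with countably many configurations, and a surjective continuous map $\phi : X \to Y$ that commutes with all shifts. Then $Y$ satisfies the countable cover conditions. That is, $Y$ is vertically constant and its projective subdynamics $P(Y) = \{ (y_{(n,0,\dots,0)})_{n \in \mathbb{Z}} : y \in Y \} \subset \Gamma^{\mathbb{Z}}$ has the following three properties: 1. $P(Y)$ is effectively closed, i.e. it is the set of all configurations in $\Gamma^{\mathbb{Z}}$ that avoid some computably enumerable set of forbidden finite words; 2. every $z \in P(Y)$ is ultimately periodic to the left and to the right, i.e. there are $p, q > 0$ with $z_n = z_{n+p}$ for all large enough $n \in \mathbb{Z}$ and $z_n = z_{n-q}$ for all small enough $n \in \mathbb{Z}$; 3. given nonempty words $u, v, w \in \Gamma^+$, it is decidable whether ${}^\infty u v w^\infty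 \in P(Y)$. -/

import Mathlib

open SymbolicDynamics.FullShift

namespace CountableCover

/-- A subshift `X ⊆ A^(ℤ^d)` is a shift of finite type if it is the set of configurations
avoiding some finite set of finite patterns. -/
def IsSFT {A : Type*} [Inhabited A] [TopologicalSpace A] {d : ℕ}
    (X : Subshift A (Fin d → ℤ)) : Prop :=
  ∃ F : Set (Pattern A (Fin d → ℤ)), F.Finite ∧ X.carrier = forbidden F

/-- A factor map between `ℤ^d`-subshifts: a surjective block code, i.e. a surjective continuous
map that commutes with all shifts. -/
structure IsFactorMap {A Γ : Type*} [TopologicalSpace A] [TopologicalSpace Γ] {d : ℕ}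
    (X : Subshift A (Fin d → ℤ)) (Y : Subshift Γ (Fin d → ℤ))
    (φ : X.carrier → Y.carrier) : Prop where
  continuous : Continuous φ
  commutes : ∀ (v : Fin d → ℤ) (x : X.carrier),
    (φ ⟨shift v x.1, X.mapsTo v x.2⟩ : (Fin d → ℤ) → Γ) = shift v (φ x).1
  surjective : Function.Surjective φ

/-- `Y` is a countably covered sofic shift: it is the image, under a block code, of a shift of
finite type that has countably many configurations. (Alphabets are finite and discrete; an
alphabet in `Type` is no restriction, and neither is a nonempty one, as an SFT cover of the empty
shift exists over every alphabet.) -/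
def IsCountablyCovered {Γ : Type*} [TopologicalSpace Γ] {d : ℕ}
    (Y : Subshift Γ (Fin d → ℤ)) : Prop :=
  ∃ (A : Type) (_ : Finite A) (_ : Inhabited A) (_ : TopologicalSpace A)
    (_ : DiscreteTopology A) (X : Subshift A (Fin d → ℤ)) (φ : X.carrier → Y.carrier),
    IsSFT X ∧ X.carrier.Countable ∧ IsFactorMap X Y φ

/-- Every configuration of `Y` has the basis vectors `e₂, …, e_d` as periods (the coordinates are
indexed from `0` here, so that `0` is the horizontal one). -/
def IsVerticallyConstant {Γ : Type*} [TopologicalSpace Γ] {d : ℕ}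
    (Y : Subshift Γ (Fin d → ℤ)) : Prop :=
  ∀ y ∈ Y.carrier, ∀ i : Fin d, 0 < (i : ℕ) → shift (Pi.single i (1 : ℤ)) y = y

/-- The point `(n, 0, …, 0)` of `ℤ^d`. -/
def rowPoint (d : ℕ) (n : ℤ) : Fin d → ℤ := fun i => if (i : ℕ) = 0 then n else 0

theorem rowPoint_add (d : ℕ) (m n : ℤ) : rowPoint d (m + n) = rowPoint d m + rowPoint d n := by
  funext i
  by_cases h : (i : ℕ) = 0 <;> simp [rowPoint, h]

/-- The central horizontal row of a configuration. -/
def row {Γ : Type*} {d : ℕ} (y : (Fin d → ℤ) → Γ) : ℤ → Γ := fun n => y (rowPoint d n)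

/-- The one-dimensional projective subdynamics `P(Y)`: the subshift of the central horizontal rows
of the configurations of `Y`. -/
def projSub {Γ : Type*} [Finite Γ] [TopologicalSpace Γ] [DiscreteTopology Γ] {d : ℕ}
    (Y : Subshift Γ (Fin d → ℤ)) : Subshift Γ ℤ where
  carrier := row '' Y.carrier
  isClosed := by
    have hc : Continuous (row : ((Fin d → ℤ) → Γ) → ℤ → Γ) :=
      continuous_pi fun n => continuous_apply (rowPoint d n)
    exact (Y.isClosed.isCompact.image hc).isClosed
  mapsTo := by
    rintro m _ ⟨y, hy, rfl⟩
    refine ⟨shift (rowPoint d m) y, Y.mapsTo _ hy, ?_⟩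
    funext n
    simp [row, shift, rowPoint_add]

/-- The word `w` occurs in `x` at position `i`. -/
def WordOccursAt {Γ : Type*} (w : List Γ) (x : ℤ → Γ) (i : ℤ) : Prop :=
  ∀ (k : ℕ) (hk : k < w.length), x (i + k) = w[k]

/-- `Z` is effectively closed: it is defined by a computably enumerable set of forbidden words.
Letters are coded by numbers; the choice of the numbering of the finite alphabet is immaterial, and
all numberings are considered. -/
def IsEffectivelyClosed {Γ : Type*} [Finite Γ] [TopologicalSpace Γ] (Z : Subshift Γ ℤ) : Prop :=
  ∀ (n : ℕ) (e : Γ ≃ Fin n), ∃ F : Set (List (Fin n)),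
    REPred (fun w => w ∈ F) ∧
      Z.carrier = {x | ∀ w ∈ F, ∀ i : ℤ, ¬ WordOccursAt (w.map e.symm) x i}

/-- `y` is ultimately periodic to the right. -/
def UltPeriodicRight {Γ : Type*} (y : ℤ → Γ) : Prop :=
  ∃ p : ℤ, 0 < p ∧ ∃ N : ℤ, ∀ n : ℤ, N ≤ n → y n = y (n + p)

/-- `y` is ultimately periodic to the left. -/
def UltPeriodicLeft {Γ : Type*} (y : ℤ → Γ) : Prop :=
  ∃ p : ℤ, 0 < p ∧ ∃ N : ℤ, ∀ n : ℤ, n ≤ N → y n = y (n - p)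

/-- The configuration `^∞ u v w ^∞`, with the first letter of `v w^∞` at position `0`. -/
def biInf {Γ : Type*} (u v w : List Γ) (hu : u ≠ []) (hw : w ≠ []) : ℤ → Γ := fun n =>
  have hu' : 0 < (u.length : ℤ) := by exact_mod_cast List.length_pos_of_ne_nil hu
  have hw' : 0 < (w.length : ℤ) := by exact_mod_cast List.length_pos_of_ne_nil hw
  if n < 0 then
    u[(n % u.length).toNat]'(by
      have h1 := Int.emod_nonneg n hu'.ne'
      have h2 := Int.emod_lt_of_pos n hu'
      omega)
  else if h : n.toNat < v.length then
    v[n.toNat]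
  else
    w[((n - v.length) % w.length).toNat]'(by
      have h1 := Int.emod_nonneg (n - v.length) hw'.ne'
      have h2 := Int.emod_lt_of_pos (n - v.length) hw'
      omega)

/-- The words `u`, `v`, `w` are nonempty and `^∞ u v w ^∞` belongs to `Z`. -/
def BiInfMem {Γ : Type*} [TopologicalSpace Γ] (Z : Subshift Γ ℤ) (u v w : List Γ) : Prop :=
  ∃ (hu : u ≠ []) (_ : v ≠ []) (hw : w ≠ []), biInf u v w hu hw ∈ Z.carrier

/-- Given nonempty words `u`, `v`, `w`, it is decidable whether `^∞ u v w ^∞ ∈ Z`. -/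
def BiInfDecidable {Γ : Type*} [Finite Γ] [TopologicalSpace Γ] (Z : Subshift Γ ℤ) : Prop :=
  ∀ (n : ℕ) (e : Γ ≃ Fin n),
    ComputablePred fun t : List (Fin n) × List (Fin n) × List (Fin n) =>
      BiInfMem Z (t.1.map e.symm) (t.2.1.map e.symm) (t.2.2.map e.symm)

/-- The countable cover conditions for a one-dimensional shift space. -/
structure CountableCoverConditionsOne {Γ : Type*} [Finite Γ] [TopologicalSpace Γ]
    (Z : Subshift Γ ℤ) : Prop where
  effectivelyClosed : IsEffectivelyClosed Z
  ultimatelyPeriodic : ∀ z ∈ Z.carrier, UltPeriodicLeft z ∧ UltPeriodicRight z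
  decidable : BiInfDecidable Z

/-- The countable cover conditions for a `d`-dimensional shift space. -/
structure CountableCoverConditions {Γ : Type*} [Finite Γ] [TopologicalSpace Γ]
    [DiscreteTopology Γ] {d : ℕ} (Y : Subshift Γ (Fin d → ℤ)) : Prop where
  verticallyConstant : IsVerticallyConstant Y
  projective : CountableCoverConditionsOne (projSub Y)

end CountableCover

namespace CountableCover

/-! ### Countably many paths in a finite graph force ultimate periodicity -/

theorem false_of_injective_of_countable {α : Type*} {f : Set ℤ → α} (hf : Function.Injective f)
    {T : Set α} (hT : T.Countable) (h : ∀ b, f b ∈ T) : False := by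
  have : Countable T := hT
  have hinj : Function.Injective (fun b => (⟨f b, h b⟩ : T)) := fun b b' hb =>
    hf (congrArg Subtype.val hb)
  have hc : Countable (Set ℤ) := hinj.countable
  obtain ⟨g, hg⟩ := exists_injective_nat (Set ℤ)
  exact Function.cantor_injective (fun b => ((g b : ℕ) : ℤ)) (Nat.cast_injective.comp hg)

/-- Two loops of the same length based at the same vertex agree, if there are only countably many
bi-infinite paths. -/
theorem loops_eq_of_countable_paths {S : Type*} {E : S → S → Prop}
    (hc : {σ : ℤ → S | ∀ n, E (σ n) (σ (n + 1))}.Countable) {L : ℤ} (hL : 0 < L) {a : S}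
    {U V : ℤ → S} (hU0 : U 0 = a) (hUL : U L = a) (hV0 : V 0 = a) (hVL : V L = a)
    (hU : ∀ t, 0 ≤ t → t < L → E (U t) (U (t + 1)))
    (hV : ∀ t, 0 ≤ t → t < L → E (V t) (V (t + 1))) {t : ℤ} (ht0 : 0 ≤ t) (htL : t < L) :
    U t = V t := by
  classical
  by_contra hne
  let W : Prop → ℤ → S := fun c => if c then U else V
  have hW0 : ∀ c, W c 0 = a := fun c => by by_cases h : c <;> simp [W, h, hU0, hV0]
  have hWL : ∀ c, W c L = a := fun c => by by_cases h : c <;> simp [W, h, hUL, hVL]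
  have hW : ∀ c t, 0 ≤ t → t < L → E (W c t) (W c (t + 1)) := fun c => by
    by_cases h : c
    · simpa [W, h] using hU
    · simpa [W, h] using hV
  -- Free concatenation: block number `m / L` runs through `U` or `V` according to whether it
  -- belongs to `b`. All blocks start and end at `a`, so every `b` gives a path, and `b` is
  -- recovered at the positions `m * L + t`, where the loops differ.
  refine false_of_injective_of_countable
    (f := fun (b : Set ℤ) (m : ℤ) => W (m / L ∈ b) (m % L)) ?_ hc ?_
  · intro b b' hbb
    ext m
    have h1 : (m * L + t) / L = m := by
      rw [add_comm, Int.add_mul_ediv_right _ _ hL.ne', Int.ediv_eq_zero_of_lt ht0 htL, zero_add]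
    have h2 : (m * L + t) % L = t := by
      rw [add_comm, Int.add_mul_emod_self_right, Int.emod_eq_of_lt ht0 htL]
    have h := congrFun hbb (m * L + t)
    simp only [h1, h2, W] at h
    by_cases hb : m ∈ b <;> by_cases hb' : m ∈ b' <;> simp only [hb, hb', if_true, if_false] at h ⊢
    · exact (hne h).elim
    · exact (hne h.symm).elim
  · intro b m
    have h0 := Int.emod_nonneg m hL.ne'
    have h1 := Int.emod_lt_of_pos m hL
    have h2 := Int.emod_add_mul_ediv m L
    have key := hW (m / L ∈ b) (m % L) h0 h1
    rcases (show m % L + 1 < L ∨ m % L + 1 = L by omega) with h | h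
    · have e1 : (m + 1) / L = m / L := by
        rw [Int.ediv_eq_iff_of_pos hL]; constructor <;> nlinarith
      have e2 : (m + 1) % L = m % L + 1 := by
        have := Int.emod_add_mul_ediv (m + 1) L
        rw [e1] at this; linarith
      simpa only [e1, e2] using key
    · have e1 : (m + 1) / L = m / L + 1 := by
        rw [Int.ediv_eq_iff_of_pos hL]; constructor <;> nlinarith
      have e2 : (m + 1) % L = 0 := by
        have := Int.emod_add_mul_ediv (m + 1) L
        rw [e1] at this; nlinarith
      simp only [e1, e2, hW0]
      rw [h, hWL] at key
      exact key

/-- In a finite directed graph with countably many bi-infinite paths, every such path is ultimately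
periodic to the right. -/
theorem ultPeriodicRight_of_countable_paths {S : Type*} [Finite S] {E : S → S → Prop}
    (hc : {σ : ℤ → S | ∀ n, E (σ n) (σ (n + 1))}.Countable) {σ : ℤ → S}
    (hσ : ∀ n, E (σ n) (σ (n + 1))) : UltPeriodicRight σ := by
  -- Pigeonhole: some vertex is visited arbitrarily far to the right.
  obtain ⟨a, ha⟩ : ∃ a, ∀ N, ∃ n, N < n ∧ σ n = a := by
    by_contra! h
    choose B hB using h
    obtain ⟨M, hM⟩ := (Set.finite_range B).bddAbove
    exact hB (σ (M + 1)) (M + 1) (by have := hM ⟨σ (M + 1), rfl⟩; omega) rfl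
  obtain ⟨i, -, hi⟩ := ha 0
  obtain ⟨j, hij, hj⟩ := ha i
  refine ⟨j - i, by omega, i, fun n hn => ?_⟩
  obtain ⟨k, hk, hka⟩ := ha (n + (j - i))
  -- The loops of `σ` over `[i, j]` and `[i, k]`, concatenated in the two possible orders, have the
  -- same length. At the chosen time one order reads `σ n` and the other `σ (n + (j - i))`.
  have key := loops_eq_of_countable_paths (L := (j - i) + (k - i)) (a := a)
    (U := fun t => if t < j - i then σ (i + t) else σ (i + t - (j - i)))
    (V := fun t => if t < k - i then σ (i + t) else σ (i + t - (k - i)))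
    (t := n + (j - i) - i) hc (by omega) ?_ ?_ ?_ ?_ ?_ ?_ (by omega) (by omega)
  · rw [if_neg (by omega), if_pos (by omega)] at key
    convert key using 2 <;> ring
  · simp [hij, hi]
  · rw [if_neg (by omega), ← hka]; congr 1; ring
  · rw [if_pos (by omega), ← hi]; congr 1; ring
  · rw [if_neg (by omega), ← hj]; congr 1; ring
  · intro t h0 h1
    rcases lt_trichotomy (t + 1) (j - i) with h | h | h
    · rw [if_pos (by omega), if_pos (by omega), ← add_assoc]; exact hσ _
    · rw [if_pos (by omega), if_neg (by omega), h, add_sub_cancel_right, hi, ← hj]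
      convert hσ (i + t) using 2; omega
    · rw [if_neg (by omega), if_neg (by omega)]
      convert hσ (i + t - (j - i)) using 2; ring
  · intro t h0 h1
    rcases lt_trichotomy (t + 1) (k - i) with h | h | h
    · rw [if_pos (by omega), if_pos (by omega), ← add_assoc]; exact hσ _
    · rw [if_pos (by omega), if_neg (by omega), h, add_sub_cancel_right, hi, ← hka]
      convert hσ (i + t) using 2; omega
    · rw [if_neg (by omega), if_neg (by omega)]
      convert hσ (i + t - (k - i)) using 2; ring

theorem ultPeriodicLeft_iff_comp_neg {S : Type*} {σ : ℤ → S} :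
    UltPeriodicLeft σ ↔ UltPeriodicRight fun n => σ (-n) := by
  constructor
  · rintro ⟨p, hp, N, h⟩
    refine ⟨p, hp, -N, fun n hn => ?_⟩
    simp only [h (-n) (by omega), neg_add, sub_eq_add_neg]
  · rintro ⟨p, hp, N, h⟩
    refine ⟨p, hp, -N, fun n hn => ?_⟩
    have := h (-n) (by omega)
    simp only [neg_neg, neg_add] at this
    rw [this, sub_eq_add_neg]

theorem ultPeriodicLeft_of_countable_paths {S : Type*} [Finite S] {E : S → S → Prop}
    (hc : {σ : ℤ → S | ∀ n, E (σ n) (σ (n + 1))}.Countable) {σ : ℤ → S}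
    (hσ : ∀ n, E (σ n) (σ (n + 1))) : UltPeriodicLeft σ := by
  rw [ultPeriodicLeft_iff_comp_neg]
  have hrev : ∀ τ : ℤ → S, (∀ n, E (τ n) (τ (n + 1))) → ∀ n, E (τ (-(n + 1))) (τ (-n)) :=
    fun τ h n => by convert h (-(n + 1)) using 2; ring
  refine ultPeriodicRight_of_countable_paths (E := fun s s' => E s' s) ?_ (hrev σ hσ)
  refine Set.Countable.mono (fun τ (hτ : ∀ n, E (τ (n + 1)) (τ n)) => ?_)
    (hc.image fun (τ : ℤ → S) n => τ (-n))
  refine ⟨fun n => τ (-n), fun n => ?_, by simp⟩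
  convert hτ (-(n + 1)) using 2; ring

/-- A bi-infinite sequence in a countable one-dimensional shift of finite type is ultimately
periodic in both directions. -/
theorem ultPeriodic_of_countable_of_windows {C : Type*} [Finite C] {r : ℕ}
    {Q : (Fin (r + 1) → C) → Prop}
    (hc : {c : ℤ → C | ∀ n : ℤ, Q fun i => c (n + (i : ℕ))}.Countable) {c : ℤ → C}
    (hcQ : ∀ n : ℤ, Q fun i => c (n + (i : ℕ))) : UltPeriodicLeft c ∧ UltPeriodicRight c := by
  -- Higher block graph: the vertices are windows, and an edge leads from an allowed window to one
  -- that overlaps it in all but one letter.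
  let E : (Fin (r + 1) → C) → (Fin (r + 1) → C) → Prop := fun s s' =>
    Q s ∧ ∀ i : Fin r, s i.succ = s' i.castSucc
  have hpath : ∀ c : ℤ → C, (∀ n : ℤ, Q fun i => c (n + (i : ℕ))) →
      ∀ n : ℤ, E (fun i => c (n + (i : ℕ))) (fun i => c (n + 1 + (i : ℕ))) := fun c h n =>
    ⟨h n, fun i => by
      simp only [Fin.val_succ, Fin.val_castSucc]; congr 1; push_cast; ring⟩
  have hread : ∀ σ : ℤ → Fin (r + 1) → C, (∀ n, E (σ n) (σ (n + 1))) →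
      ∀ n i, σ n i = σ (n + ((i : Fin (r + 1)) : ℕ)) 0 := by
    intro σ h n i
    obtain ⟨i, hi⟩ := i
    induction i generalizing n with
    | zero => simp
    | succ i ih =>
      have h1 := (h n).2 ⟨i, by omega⟩
      simp only [Fin.succ_mk, Fin.castSucc_mk] at h1
      rw [h1, ih (n + 1) (by omega)]
      have : n + 1 + (i : ℤ) = n + ((i + 1 : ℕ) : ℤ) := by push_cast; ring
      exact congrArg (fun m => σ m 0) this
  have hcE : {σ : ℤ → Fin (r + 1) → C | ∀ n, E (σ n) (σ (n + 1))}.Countable := by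
    refine Set.Countable.mono ?_ (hc.image fun (c : ℤ → C) n (i : Fin (r + 1)) => c (n + (i : ℕ)))
    intro σ hσ
    refine ⟨fun n => σ n 0, fun n => ?_, ?_⟩
    · have : (fun i : Fin (r + 1) => σ (n + (i : ℕ)) 0) = σ n :=
        funext fun i => (hread σ hσ n i).symm
      rw [this]; exact (hσ n).1
    · funext n i; exact (hread σ hσ n i).symm
  constructor
  · obtain ⟨p, hp, N, h⟩ := ultPeriodicLeft_of_countable_paths hcE (hpath c hcQ)
    exact ⟨p, hp, N, fun n hn => by simpa using congrFun (h n hn) 0⟩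
  · obtain ⟨p, hp, N, h⟩ := ultPeriodicRight_of_countable_paths hcE (hpath c hcQ)
    exact ⟨p, hp, N, fun n hn => by simpa using congrFun (h n hn) 0⟩

/-- The congruence form passes to multiples of the period, so that several periods can later be
replaced by a common multiple. -/
theorem UltPeriodicRight.exists_eq_of_modEq {C : Type*} {c : ℤ → C} (h : UltPeriodicRight c) :
    ∃ p : ℕ, 0 < p ∧ ∃ N : ℤ, ∀ m n : ℤ, N ≤ m → N ≤ n → m ≡ n [ZMOD p] → c m = c n := by
  obtain ⟨p, hp, N, h⟩ := h
  lift p to ℕ using hp.le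
  refine ⟨p, by exact_mod_cast hp, N, ?_⟩
  have hk : ∀ (k : ℕ) (n : ℤ), N ≤ n → c n = c (n + p * k) := by
    intro k
    induction k with
    | zero => simp
    | succ k ih =>
      intro n hn
      have : (0 : ℤ) ≤ p * k := by positivity
      rw [ih n hn, h _ (by omega)]
      congr 1; push_cast; ring
  have hle : ∀ m n : ℤ, N ≤ m → m ≤ n → m ≡ n [ZMOD p] → c m = c n := by
    intro m n hm hmn hmod
    obtain ⟨k, hk'⟩ := hmod.dvd
    have : 0 ≤ k := by
      by_contra hneg
      have : (p : ℤ) * k < 0 := mul_neg_of_pos_of_neg hp (by omega)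
      omega
    lift k to ℕ using this
    rw [hk k m hm, ← hk', add_sub_cancel]
  intro m n hm hn hmod
  rcases le_total m n with h' | h'
  · exact hle m n hm h' hmod
  · exact (hle n m hn h' hmod.symm).symm

theorem UltPeriodicLeft.exists_eq_of_modEq {C : Type*} {c : ℤ → C} (h : UltPeriodicLeft c) :
    ∃ p : ℕ, 0 < p ∧ ∃ N : ℤ, ∀ m n : ℤ, m ≤ N → n ≤ N → m ≡ n [ZMOD p] → c m = c n := by
  obtain ⟨p, hp, N, h⟩ := (ultPeriodicLeft_iff_comp_neg.1 h).exists_eq_of_modEq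
  refine ⟨p, hp, -N, fun m n hm hn hmod => ?_⟩
  simpa using h (-m) (-n) (by omega) (by omega) hmod.neg

/-! ### From a factor map to a local rule -/

/-- A local rule relates the letters of a configuration over `A` in a finite window, whose cells
have nonnegative offsets, to a letter of `Γ`. -/
structure LocalRule (d : ℕ) (A Γ : Type*) where
  /-- The number of cells of the window. -/
  size : ℕ
  /-- The cells of the window. -/
  offset : Fin size → Fin d → ℕ
  /-- The allowed pairs. -/
  rel : (Fin size → A) → Γ → Prop

namespace LocalRule

/-- The letters of `x` in the window at position `v`. -/
def window {d : ℕ} {A Γ : Type*} (ρ : LocalRule d A Γ) (x : (Fin d → ℤ) → A) (v : Fin d → ℤ) :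
    Fin ρ.size → A :=
  fun i => x fun j => v j + ρ.offset i j

/-- The configurations `x` and `y` are related by the rule at every position. -/
def Tiles {d : ℕ} {A Γ : Type*} (ρ : LocalRule d A Γ) (x : (Fin d → ℤ) → A)
    (y : (Fin d → ℤ) → Γ) : Prop :=
  ∀ v, ρ.rel (ρ.window x v) (y v)

/-- Each window admits at most one letter. -/
def Functional {d : ℕ} {A Γ : Type*} (ρ : LocalRule d A Γ) : Prop :=
  ∀ w c c', ρ.rel w c → ρ.rel w c' → c = c'

/-- The set of covering configurations. -/
def cover {d : ℕ} {A Γ : Type*} (ρ : LocalRule d A Γ) : Set ((Fin d → ℤ) → A) :=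
  {x | ∃ y, ρ.Tiles x y}

end LocalRule

/-- A continuous map from a compact set of configurations to a discrete space depends on finitely
many cells only. -/
theorem exists_finset_of_continuous {A G B : Type*} [TopologicalSpace A] [DiscreteTopology A]
    [Finite A] [TopologicalSpace B] [DiscreteTopology B] {K : Set (G → A)} (hK : IsClosed K)
    {f : K → B} (hf : Continuous f) :
    ∃ U : Finset G, ∀ x x' : K, (∀ g ∈ U, x.1 g = x'.1 g) → f x = f x' := by
  classical
  by_contra! h
  have : CompactSpace K := isCompact_iff_compactSpace.1 hK.isCompact
  -- Pairs that agree on `U` but have different images form a directed family of nonempty compact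
  -- sets. A common element would be a pair of equal configurations with different images.
  let T : Finset G → Set (K × K) := fun U => {p | (∀ g ∈ U, p.1.1 g = p.2.1 g) ∧ f p.1 ≠ f p.2}
  have hcl : ∀ U, IsClosed (T U) := by
    intro U
    have h1 : IsClosed {p : K × K | ∀ g ∈ U, p.1.1 g = p.2.1 g} := by
      simp only [Set.ofPred_forall]
      exact isClosed_biInter fun g _ => isClosed_eq
        ((continuous_apply g).comp (continuous_subtype_val.comp continuous_fst))
        ((continuous_apply g).comp (continuous_subtype_val.comp continuous_snd))
    have h2 : IsClosed {p : K × K | f p.1 ≠ f p.2} := by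
      have : {p : K × K | f p.1 ≠ f p.2} = (fun p : K × K => (f p.1, f p.2)) ⁻¹' {q | q.1 ≠ q.2} :=
        rfl
      rw [this]
      exact (isClosed_discrete _).preimage (by fun_prop)
    exact h1.inter h2
  obtain ⟨p, hp⟩ := IsCompact.nonempty_iInter_of_directed_nonempty_isCompact_isClosed T
    (fun U V => ⟨U ∪ V, fun p hp => ⟨fun g hg => hp.1 g (Finset.mem_union_left _ hg), hp.2⟩,
      fun p hp => ⟨fun g hg => hp.1 g (Finset.mem_union_right _ hg), hp.2⟩⟩)
    (fun U => by obtain ⟨x, x', h1, h2⟩ := h U; exact ⟨(x, x'), h1, h2⟩)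
    (fun U => (hcl U).isCompact) hcl
  rw [Set.mem_iInter] at hp
  refine (hp ∅).2 (congrArg f (Subtype.ext (funext fun g => (hp {g}).1 g (by simp))))

/-- A factor of a shift of finite type is described by a finite set of cells. -/
theorem exists_window_of_isFactorMap {A Γ : Type*} [Finite A] [Inhabited A] [TopologicalSpace A]
    [DiscreteTopology A] [TopologicalSpace Γ] [DiscreteTopology Γ] {d : ℕ}
    {X : Subshift A (Fin d → ℤ)} {Y : Subshift Γ (Fin d → ℤ)} {φ : X.carrier → Y.carrier}
    (hX : IsSFT X) (hφ : IsFactorMap X Y φ) :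
    ∃ U : Finset (Fin d → ℤ),
      (∀ x x' : X.carrier, (∀ u ∈ U, x.1 u = x'.1 u) → (φ x).1 0 = (φ x').1 0) ∧
      ∀ (x : (Fin d → ℤ) → A) (y : (Fin d → ℤ) → Γ),
        (∀ v, ∃ x' : X.carrier, (∀ u ∈ U, x (v + u) = x'.1 u) ∧ (φ x').1 0 = y v) ↔
          ∃ hx : x ∈ X.carrier, (φ ⟨x, hx⟩).1 = y := by
  classical
  obtain ⟨F, hF, hXF⟩ := hX
  obtain ⟨D, hD⟩ := exists_finset_of_continuous X.isClosed (f := fun x => (φ x).1 0)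
    ((continuous_apply (0 : Fin d → ℤ)).comp (continuous_subtype_val.comp hφ.continuous))
  have hval : ∀ (x : X.carrier) v, (φ x).1 v = (φ ⟨shift v x.1, X.mapsTo v x.2⟩).1 0 := by
    intro x v
    rw [hφ.commutes v x]; simp
  -- A window must fix the letter of the image, hence `D`, and show every forbidden pattern, hence
  -- the supports.
  refine ⟨D ∪ hF.toFinset.biUnion (fun p => p.support),
    fun x x' h => hD x x' fun g hg => h g (Finset.mem_union_left _ hg), fun x y => ⟨fun h => ?_, ?_⟩⟩
  · have hx : x ∈ X.carrier := by
      rw [hXF]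
      intro p hp g hocc
      obtain ⟨x', hx', -⟩ := h g
      have hx'F : x'.1 ∈ forbidden F := hXF ▸ x'.2
      refine hx'F p hp 0 fun u hu => ?_
      rw [zero_add, ← hx' u (Finset.mem_union_right _ ?_), hocc u hu]
      exact Finset.mem_biUnion.2 ⟨p, hF.mem_toFinset.2 hp, hu⟩
    refine ⟨hx, funext fun v => ?_⟩
    obtain ⟨x', hx', hy⟩ := h v
    rw [hval, ← hy]
    exact hD _ _ fun g hg => hx' g (Finset.mem_union_left _ hg)
  · rintro ⟨hx, rfl⟩ v
    exact ⟨⟨shift v x, X.mapsTo v hx⟩, fun u _ => rfl, (hval ⟨x, hx⟩ v).symm⟩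

/-- A countably covered sofic shift is described by a functional local rule over a finite
alphabet `Fin (a + 1)` with countably many covering configurations. -/
theorem IsCountablyCovered.exists_localRule {Γ : Type*} [TopologicalSpace Γ] [DiscreteTopology Γ]
    {d : ℕ} {Y : Subshift Γ (Fin d → ℤ)} (h : IsCountablyCovered Y) :
    ∃ (a : ℕ) (ρ : LocalRule d (Fin (a + 1)) Γ), ρ.Functional ∧ ρ.cover.Countable ∧
      ∀ y, y ∈ Y.carrier ↔ ∃ x, ρ.Tiles x y := by
  classical
  obtain ⟨A, _, _, _, _, X, φ, hX, hcount, hφ⟩ := h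
  obtain ⟨U, hU, hUX⟩ := exists_window_of_isFactorMap hX hφ
  obtain ⟨a, ⟨eA⟩⟩ : ∃ a, Nonempty (A ≃ Fin (a + 1)) := by
    obtain ⟨n, ⟨e⟩⟩ := Finite.exists_equiv_fin A
    cases n with
    | zero => exact (e default).elim0
    | succ n => exact ⟨n, ⟨e⟩⟩
  -- Translation by `s` makes all offsets natural numbers, so that cells can be coded by lists of
  -- naturals.
  let s : Fin d → ℤ := fun j => ∑ u ∈ U, |u j|
  have hs : ∀ u ∈ U, ∀ j, 0 ≤ u j + s j := fun u hu j => by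
    have h1 : |u j| ≤ s j := Finset.single_le_sum (f := fun u : Fin d → ℤ => |u j|)
      (fun _ _ => abs_nonneg _) hu
    have := neg_abs_le (u j)
    linarith
  let ρ : LocalRule d (Fin (a + 1)) Γ :=
    { size := U.card
      offset := fun i j => ((U.equivFin.symm i).1 j + s j).toNat
      rel := fun w c => ∃ x' : X.carrier,
        (∀ i, eA.symm (w i) = x'.1 (U.equivFin.symm i).1) ∧ (φ x').1 0 = c }
  have htiles : ∀ x y, ρ.Tiles x y ↔
      ∃ hx : (fun v => eA.symm (x (v + s))) ∈ X.carrier, (φ ⟨_, hx⟩).1 = y := by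
    intro x y
    rw [← hUX]
    refine forall_congr' fun v => exists_congr fun x' => and_congr_left' ?_
    have hcell : ∀ i, (fun j => v j + ((ρ.offset i j : ℕ) : ℤ)) = v + (U.equivFin.symm i).1 + s :=
      fun i => funext fun j => by
        simp only [ρ, Int.toNat_of_nonneg (hs _ (U.equivFin.symm i).2 j), Pi.add_apply]; ring
    constructor
    · intro hw u hu
      have := hw (U.equivFin ⟨u, hu⟩)
      simpa only [LocalRule.window, hcell, Equiv.symm_apply_apply] using this
    · intro hw i
      simpa only [LocalRule.window, hcell] using hw _ (U.equivFin.symm i).2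
  refine ⟨a, ρ, ?_, ?_, fun y => ⟨fun hy => ?_, ?_⟩⟩
  · rintro w c c' ⟨x, hx, rfl⟩ ⟨x', hx', rfl⟩
    refine hU x x' fun u hu => ?_
    have h1 := hx (U.equivFin ⟨u, hu⟩)
    have h2 := hx' (U.equivFin ⟨u, hu⟩)
    simp only [Equiv.symm_apply_apply] at h1 h2
    rw [← h1, ← h2]
  · refine Set.MapsTo.countable_of_injOn (f := fun x v => eA.symm (x (v + s)))
      (t := X.carrier) ?_ ?_ hcount
    · rintro x ⟨y, hy⟩
      exact ((htiles x y).1 hy).1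
    · intro x _ x' _ hxx
      funext v
      simpa using congrFun hxx (v - s)
  · obtain ⟨x, hx⟩ := hφ.surjective ⟨y, hy⟩
    have hx' : (fun v => eA.symm ((fun v => eA (x.1 (v - s))) (v + s))) = x.1 := by simp
    have hmem := x.2
    rw [← hx'] at hmem
    refine ⟨fun v => eA (x.1 (v - s)), (htiles _ _).2 ⟨hmem, ?_⟩⟩
    have : (⟨_, hmem⟩ : X.carrier) = x := Subtype.ext hx'
    rw [this, hx]
  · rintro ⟨x, hx⟩
    obtain ⟨hx', rfl⟩ := (htiles x y).1 hx
    exact (φ ⟨_, hx'⟩).2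

/-! ### Finite orbits in countable compact systems -/

/-- A nonempty countable compact set that is invariant under a group of homeomorphisms contains a
point with a finite orbit. -/
theorem exists_finite_orbit_of_countable {E G : Type*} [TopologicalSpace E] [T2Space E]
    [AddGroup G] {act : G → E → E} (hcont : ∀ g, Continuous (act g)) (hzero : ∀ x, act 0 x = x)
    (hadd : ∀ g h x, act (g + h) x = act h (act g x)) {K : Set E} (hK : IsCompact K)
    (hne : K.Nonempty) (hcount : K.Countable) (hinv : ∀ g, Set.MapsTo (act g) K K) :
    ∃ x ∈ K, (Set.range fun g => act g x).Finite := by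
  let 𝒮 : Set (Set E) := {M | M ⊆ K ∧ IsClosed M ∧ M.Nonempty ∧ ∀ g, Set.MapsTo (act g) M M}
  obtain ⟨M, -, hM⟩ := zorn_superset_nonempty 𝒮 (by
    intro c hc hchain hcne
    refine ⟨⋂₀ c, ⟨?_, ?_, ?_, ?_⟩, fun s hs => Set.sInter_subset_of_mem hs⟩
    · obtain ⟨s, hs⟩ := hcne
      exact (Set.sInter_subset_of_mem hs).trans (hc hs).1
    · exact isClosed_sInter fun s hs => (hc hs).2.1
    · have := hcne.coe_sort
      rw [Set.sInter_eq_iInter]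
      refine IsCompact.nonempty_iInter_of_directed_nonempty_isCompact_isClosed _
        (DirectedOn.directed_val (IsChain.directedOn hchain.symm)) (fun s => (hc s.2).2.2.1)
        (fun s => hK.of_isClosed_subset (hc s.2).2.1 (hc s.2).1) (fun s => (hc s.2).2.1)
    · intro g x hx
      rw [Set.mem_sInter] at hx ⊢
      exact fun s hs => (hc hs).2.2.2 g (hx s hs)) K ⟨subset_rfl, hK.isClosed, hne, hinv⟩
  obtain ⟨hMK, hMcl, hMne, hMinv⟩ := hM.prop
  have hMc : IsCompact M := hK.of_isClosed_subset hMcl hMK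
  -- Baire: the countable compact set `M` is the union of its points, so one of them is isolated in
  -- `M`.
  obtain ⟨x, hxM, O, hO, hxO⟩ : ∃ x ∈ M, ∃ O, IsOpen O ∧ ∀ y ∈ M, y ∈ O ↔ y = x := by
    have : CompactSpace M := isCompact_iff_compactSpace.1 hMc
    have : Countable M := hcount.mono hMK
    have : Nonempty M := hMne.coe_sort
    obtain ⟨x, y, hy⟩ := nonempty_interior_of_iUnion_of_closed (f := fun x : M => ({x} : Set M))
      (fun x => isClosed_singleton) (by ext; simp)
    have hyx : y = x := Set.mem_singleton_iff.1 (interior_subset hy)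
    subst hyx
    obtain ⟨O, hO, hOy⟩ := isOpen_induced_iff.1 (isOpen_interior (s := ({y} : Set M)))
    refine ⟨y, y.2, O, hO, fun z hz => ⟨fun hzO => ?_, ?_⟩⟩
    · have : (⟨z, hz⟩ : M) ∈ interior ({y} : Set M) := hOy ▸ hzO
      exact congrArg Subtype.val (Set.mem_singleton_iff.1 (interior_subset this))
    · rintro rfl
      have : y ∈ Subtype.val ⁻¹' O := hOy.symm ▸ hy
      exact this
  -- The points whose orbit avoids `O` form a closed invariant subset of `M`. If it were nonempty it
  -- would be `M` by minimality, but `x` is not in it.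
  have hreach : ∀ y ∈ M, ∃ g, act g y = x := by
    intro y hy
    by_contra! hno
    have hmem : {y ∈ M | ∀ g, act g y ∉ O} ∈ 𝒮 := by
      refine ⟨fun z hz => hMK hz.1, ?_, ⟨y, hy, fun g hg => hno g ?_⟩, fun g z hz => ?_⟩
      · refine hMcl.inter (?_ : IsClosed {y | ∀ g, act g y ∉ O})
        rw [Set.ofPred_forall]
        exact isClosed_iInter fun g => (hO.preimage (hcont g)).isClosed_compl
      · exact (hxO _ (hMinv g hy)).1 hg
      · refine ⟨hMinv g hz.1, fun h => ?_⟩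
        rw [← hadd]
        exact hz.2 _
    have := (hM.le_of_le hmem (fun z hz => hz.1) hxM).2 0
    rw [hzero] at this
    exact this ((hxO x hxM).2 rfl)
  refine ⟨x, hMK hxM, Set.Finite.subset ?_ (Set.range_subset_iff.2 fun g => hMinv g hxM)⟩
  -- Each preimage of `O` meets `M` only in `act (-g) x`, so a finite subcover makes `M` finite.
  obtain ⟨t, ht⟩ := hMc.elim_finite_subcover (fun g => act g ⁻¹' O)
    (fun g => hO.preimage (hcont g)) (fun y hy => by
      obtain ⟨g, hg⟩ := hreach y hy
      exact Set.mem_iUnion.2 ⟨g, by rw [Set.mem_preimage, hg]; exact (hxO x hxM).2 rfl⟩)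
  refine (t.finite_toSet.image fun g => act (-g) x).subset fun y hy => ?_
  obtain ⟨g, hg, hgy⟩ := Set.mem_iUnion₂.1 (ht hy)
  have hgx : act g y = x := (hxO _ (hMinv g hy)).1 hgy
  exact ⟨g, hg, by simp only []; rw [← hgx, ← hadd, add_neg_cancel, hzero]⟩

/-! ### Periodic tilings and compactness -/

namespace LocalRule

/-- A row that is tiled has a tiling with a vertical period, if the cover is countable. -/
theorem exists_verticallyPeriodic {k : ℕ} {A Γ : Type*} [Finite A] {ρ : LocalRule (k + 1) A Γ}
    (hc : ρ.cover.Countable) {z : ℤ → Γ} (h : ∃ x, ρ.Tiles x fun v => z (v 0)) :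
    ∃ x, ρ.Tiles x (fun v => z (v 0)) ∧ ∃ P : ℕ, 0 < P ∧ ∀ v v' : Fin (k + 1) → ℤ,
      v 0 = v' 0 → (∀ j : Fin k, v j.succ ≡ v' j.succ [ZMOD P]) → x v = x v' := by
  classical
  let : TopologicalSpace A := ⊥
  have : DiscreteTopology A := ⟨rfl⟩
  let up : (Fin k → ℤ) → Fin (k + 1) → ℤ := fun g => Fin.cons 0 g
  have hup0 : up 0 = 0 := by
    funext j; refine Fin.cases ?_ (fun j => ?_) j <;> simp [up]
  have hupadd : ∀ g g', up (g + g') = up g' + up g := fun g g' => by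
    funext j; refine Fin.cases ?_ (fun j => ?_) j <;> simp [up, add_comm]
  let act : (Fin k → ℤ) → ((Fin (k + 1) → ℤ) → A) → (Fin (k + 1) → ℤ) → A :=
    fun g x v => x (v + up g)
  have hzero : ∀ x, act 0 x = x := fun x => by simp [act, hup0]
  have hadd : ∀ g g' x, act (g + g') x = act g' (act g x) := fun g g' x => by
    simp [act, hupadd, add_assoc]
  have hclosed : IsClosed {x | ρ.Tiles x fun v => z (v 0)} := by
    simp only [Tiles, Set.ofPred_forall]
    refine isClosed_iInter fun v => ?_
    have hw : Continuous fun x => ρ.window x v := continuous_pi fun i => continuous_apply _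
    exact (isClosed_discrete {w | ρ.rel w (z (v 0))}).preimage hw
  obtain ⟨x, hx, hfin⟩ := exists_finite_orbit_of_countable (act := act)
    (fun g => continuous_pi fun v => continuous_apply _) hzero hadd hclosed.isCompact h
    (hc.mono fun x hx => show x ∈ ρ.cover from ⟨fun v => z (v 0), hx⟩) (fun g x hx v => by
      have h1 := hx (v + up g)
      have h2 : (v + up g) 0 = v 0 := by simp [up]
      have h3 : ρ.window (act g x) v = ρ.window x (v + up g) := by
        funext i
        simp only [window, act]
        congr 1
        funext j
        simp only [Pi.add_apply]; ring
      simp only [h2, ← h3] at h1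
      exact h1)
  let H : AddSubgroup (Fin k → ℤ) :=
    { carrier := {g | act g x = x}
      zero_mem' := hzero x
      add_mem' := fun {g g'} hg hg' => by
        simp only [Set.mem_ofPred_eq] at hg hg' ⊢
        rw [hadd, hg, hg']
      neg_mem' := fun {g} hg => by
        simp only [Set.mem_ofPred_eq] at hg ⊢
        nth_rw 1 [← hg]
        rw [← hadd, add_neg_cancel, hzero] }
  -- The stabilizer `H` meets every vertical axis nontrivially, since two multiples of a basis
  -- vector act alike on `x`.
  have hper : ∀ i : Fin k, ∃ p : ℕ, 0 < p ∧ Pi.single i (p : ℤ) ∈ H := by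
    intro i
    have := hfin.to_subtype
    obtain ⟨m, n, hmn, heq⟩ := Finite.exists_ne_map_eq_of_infinite
      (fun n : ℕ => (⟨act (Pi.single i (n : ℤ)) x, _, rfl⟩ : Set.range fun g => act g x))
    wlog hlt : m < n generalizing m n
    · exact this n m hmn.symm heq.symm (by omega)
    refine ⟨n - m, by omega, ?_⟩
    have heq' : act (Pi.single i (m : ℤ)) x = act (Pi.single i (n : ℤ)) x :=
      congrArg Subtype.val heq
    have h1 := congrArg (act (-Pi.single i (m : ℤ))) heq'
    rw [← hadd, ← hadd, add_neg_cancel, hzero] at h1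
    rw [Nat.cast_sub hlt.le, Pi.single_sub, sub_eq_add_neg]
    exact h1.symm
  choose p hp hpH using hper
  refine ⟨x, hx, ∏ i, p i, Finset.prod_pos fun i _ => hp i, fun v v' h0 hmod => ?_⟩
  have hg : (fun j : Fin k => v' j.succ - v j.succ) ∈ H := by
    rw [← Finset.univ_sum_single (fun j : Fin k => v' j.succ - v j.succ)]
    refine H.sum_mem fun i _ => ?_
    obtain ⟨c, hc⟩ : (p i : ℤ) ∣ v' i.succ - v i.succ :=
      (Int.natCast_dvd_natCast.2 (Finset.dvd_prod_of_mem p (Finset.mem_univ i))).trans (hmod i).dvd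
    have : Pi.single i (v' i.succ - v i.succ) = c • (Pi.single i (p i : ℤ) : Fin k → ℤ) := by
      rw [← Pi.single_smul, hc, smul_eq_mul, mul_comm]
    rw [this]
    exact H.zsmul_mem (hpH i) c
  have h1 : act (fun j : Fin k => v' j.succ - v j.succ) x = x := hg
  rw [← congrFun h1 v]
  simp only [act]
  congr 1
  funext j
  refine Fin.cases ?_ (fun j => ?_) j <;> simp [up, h0]

/-- The relation between positions that a configuration cannot distinguish if it has period `P`
vertically, and also horizontally at distance `N` from the origin. -/
def PeriodEquiv {k : ℕ} (P N : ℕ) (v v' : Fin (k + 1) → ℤ) : Prop :=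
  (∀ j : Fin k, v j.succ ≡ v' j.succ [ZMOD P]) ∧
    (v 0 = v' 0 ∨ v 0 ≡ v' 0 [ZMOD P] ∧
      ((N : ℤ) ≤ v 0 ∧ (N : ℤ) ≤ v' 0 ∨ v 0 ≤ -N ∧ v' 0 ≤ -N))

/-- A row that is tiled has a tiling that is periodic vertically and, outside of an interval,
horizontally, if the cover is countable. -/
theorem exists_eventuallyPeriodic {k : ℕ} {A Γ : Type*} [Finite A] {ρ : LocalRule (k + 1) A Γ}
    (hc : ρ.cover.Countable) {z : ℤ → Γ} (h : ∃ x, ρ.Tiles x fun v => z (v 0)) :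
    ∃ x, ρ.Tiles x (fun v => z (v 0)) ∧ ∃ P : ℕ, 0 < P ∧ ∃ N : ℕ, ∀ v v' : Fin (k + 1) → ℤ,
      PeriodEquiv P N v v' → x v = x v' := by
  obtain ⟨x, hx, P, hP, hper⟩ := exists_verticallyPeriodic hc h
  have : NeZero P := ⟨hP.ne'⟩
  -- A vertically periodic configuration is a sequence of columns, each a function on the finite
  -- group `(ZMod P)^k`.
  let conf : (ℤ → (Fin k → ZMod P) → A) → (Fin (k + 1) → ℤ) → A :=
    fun c v => c (v 0) fun j => (v j.succ : ZMod P)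
  let pt : ℤ → (Fin k → ZMod P) → Fin (k + 1) → ℤ :=
    fun n q => Fin.cons n fun j => ((q j).val : ℤ)
  have hpt0 : ∀ n q, pt n q 0 = n := fun n q => rfl
  have hpt : ∀ n q (j : Fin k), ((pt n q j.succ : ℤ) : ZMod P) = q j := fun n q j => by
    simp [pt]
  obtain ⟨c, hcx⟩ : ∃ c, conf c = x := by
    refine ⟨fun n q => x (pt n q), funext fun v => ?_⟩
    refine hper _ _ (hpt0 _ _) fun j => ?_
    rw [← ZMod.intCast_eq_intCast_iff, hpt]
  obtain ⟨r, hr⟩ : ∃ r, ∀ i, ρ.offset i 0 < r + 1 := by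
    obtain ⟨r, hr⟩ := (Set.finite_range fun i => ρ.offset i 0).bddAbove
    exact ⟨r, fun i => Nat.lt_succ_of_le (hr ⟨i, rfl⟩)⟩
  -- The letter below each window is left free, because a condition involving `z` would depend on
  -- the position `n`. Countability survives, as `cover` allows an arbitrary `y`.
  let Q : (Fin (r + 1) → (Fin k → ZMod P) → A) → Prop := fun w => ∀ q : Fin k → ZMod P,
    ∃ c, ρ.rel (fun i => w ⟨ρ.offset i 0, hr i⟩ fun j => q j + (ρ.offset i j.succ : ZMod P)) c
  have hwin : ∀ c v, ρ.window (conf c) v = fun i => c (v 0 + ρ.offset i 0)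
      fun j => (v j.succ : ZMod P) + (ρ.offset i j.succ : ZMod P) := fun c v => by
    funext i; simp [window, conf]
  have hcount : {c : ℤ → (Fin k → ZMod P) → A | ∀ n : ℤ, Q fun i => c (n + (i : ℕ))}.Countable := by
    refine Set.MapsTo.countable_of_injOn (f := conf) (t := ρ.cover) ?_ ?_ hc
    · intro c hcQ
      have : ∀ v, ∃ γ, ρ.rel (ρ.window (conf c) v) γ := fun v => by
        rw [hwin]; exact hcQ (v 0) fun j => (v j.succ : ZMod P)
      choose y hy using this
      exact ⟨y, hy⟩
    · intro c _ c' _ hcc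
      funext n q
      have := congrFun hcc (pt n q)
      simpa only [conf, hpt, hpt0] using this
  have hQ : ∀ n : ℤ, Q fun i => c (n + (i : ℕ)) := fun n q => by
    refine ⟨z n, ?_⟩
    have h1 := hx (pt n q)
    have h2 := hwin c (pt n q)
    rw [hcx] at h2
    rw [h2] at h1
    simpa only [hpt, hpt0] using h1
  obtain ⟨hl, hr⟩ := ultPeriodic_of_countable_of_windows hcount hQ
  obtain ⟨p, hp, M, hM⟩ := hl.exists_eq_of_modEq
  obtain ⟨p', hp', M', hM'⟩ := hr.exists_eq_of_modEq
  -- A common multiple of the vertical, left and right periods, and a threshold beyond both bounds.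
  refine ⟨x, hx, P * p * p', by positivity, M.natAbs + M'.natAbs, fun v v' ⟨hv, h0⟩ => ?_⟩
  have h1 : c (v 0) = c (v' 0) := by
    rcases h0 with h0 | ⟨hmod, h0 | h0⟩
    · rw [h0]
    · exact hM' _ _ (by omega) (by omega) (hmod.of_dvd (by push_cast; exact ⟨P * p, by ring⟩))
    · exact hM _ _ (by omega) (by omega) (hmod.of_dvd (by push_cast; exact ⟨P * p', by ring⟩))
  have h2 : (fun j : Fin k => (v j.succ : ZMod P)) = fun j => (v' j.succ : ZMod P) := by
    funext j
    rw [ZMod.intCast_eq_intCast_iff]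
    exact (hv j).of_dvd (by push_cast; exact ⟨p * p', by ring⟩)
  rw [← hcx]
  simp only [conf, h1, h2]

theorem exists_offset_le {d : ℕ} {A Γ : Type*} (ρ : LocalRule d A Γ) :
    ∃ r, ∀ i j, ρ.offset i j ≤ r := by
  obtain ⟨r, hr⟩ := (Set.finite_range fun p : Fin ρ.size × Fin d => ρ.offset p.1 p.2).bddAbove
  exact ⟨r, fun i j => hr ⟨(i, j), rfl⟩⟩

/-- The rows of a functional rule with a countable cover are ultimately periodic. -/
theorem ultPeriodic_of_tiles {k : ℕ} {A Γ : Type*} [Finite A] {ρ : LocalRule (k + 1) A Γ}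
    (hρ : ρ.Functional) (hc : ρ.cover.Countable) {z : ℤ → Γ}
    (h : ∃ x, ρ.Tiles x fun v => z (v 0)) : UltPeriodicLeft z ∧ UltPeriodicRight z := by
  obtain ⟨x, hx, P, hP, N, hper⟩ := exists_eventuallyPeriodic hc h
  obtain ⟨r, hr⟩ := ρ.exists_offset_le
  -- On the left the bound moves by `r`, so that the entire window stays in the periodic region.
  have key : ∀ m n : ℤ, m ≡ n [ZMOD P] → ((N : ℤ) ≤ m ∧ (N : ℤ) ≤ n ∨
      m ≤ -(N + r : ℕ) ∧ n ≤ -(N + r : ℕ)) → z m = z n := by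
    intro m n hmod hmn
    have h1 := hx (Fin.cons m fun _ => 0)
    have h2 := hx (Fin.cons n fun _ => 0)
    simp only [Fin.cons_zero] at h1 h2
    refine hρ _ _ _ h1 ?_
    convert h2 using 1
    funext i
    have := hr i 0
    refine hper _ _ ⟨fun j => by simp [Int.ModEq.refl], Or.inr ⟨?_, ?_⟩⟩
    · simpa using hmod.add_right _
    · simp only [Fin.cons_zero]; omega
  exact ⟨⟨P, by exact_mod_cast hP, -(N + r : ℕ), fun n hn => key _ _ (by simp) (by omega)⟩,
    ⟨P, by exact_mod_cast hP, N, fun n hn => key _ _ (by simp) (by omega)⟩⟩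

/-- Compactness: a row is tiled if arbitrarily large boxes can be tiled. -/
theorem exists_tiles_of_boxes {k : ℕ} {A Γ : Type*} [Finite A] {ρ : LocalRule (k + 1) A Γ}
    {z : ℤ → Γ} (h : ∀ N : ℕ, ∃ x, ∀ v : Fin (k + 1) → ℤ, (∀ j, |v j| ≤ N) →
      ρ.rel (ρ.window x v) (z (v 0))) : ∃ x, ρ.Tiles x fun v => z (v 0) := by
  let : TopologicalSpace A := ⊥
  have : DiscreteTopology A := ⟨rfl⟩
  let K : ℕ → Set ((Fin (k + 1) → ℤ) → A) := fun N =>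
    {x | ∀ v : Fin (k + 1) → ℤ, (∀ j, |v j| ≤ N) → ρ.rel (ρ.window x v) (z (v 0))}
  have hcl : ∀ N, IsClosed (K N) := fun N => by
    simp only [K, Set.ofPred_forall]
    refine isClosed_iInter fun v => isClosed_iInter fun _ => ?_
    have hw : Continuous fun x => ρ.window x v := continuous_pi fun i => continuous_apply _
    exact (isClosed_discrete {w | ρ.rel w (z (v 0))}).preimage hw
  obtain ⟨x, hx⟩ := IsCompact.nonempty_iInter_of_sequence_nonempty_isCompact_isClosed K
    (fun N x hx v hv => hx v fun j => (hv j).trans (by push_cast; linarith)) h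
    (hcl 0).isCompact hcl
  rw [Set.mem_iInter] at hx
  refine ⟨x, fun v => hx (∑ j, (v j).natAbs) v fun j => ?_⟩
  have : (v j).natAbs ≤ ∑ j, (v j).natAbs :=
    Finset.single_le_sum (f := fun j => (v j).natAbs) (fun _ _ => Nat.zero_le _) (Finset.mem_univ j)
  rw [Int.abs_eq_natAbs]
  exact_mod_cast this

end LocalRule

/-! ### Primitive recursive tools -/

/-- All words of a given length over a list of letters. -/
def words {α : Type*} (l : List α) : ℕ → List (List α)
  | 0 => [[]]
  | n + 1 => (words l n).flatMap fun t => l.map fun c => c :: t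

theorem mem_words {α : Type*} {l : List α} {n : ℕ} {t : List α} :
    t ∈ words l n ↔ t.length = n ∧ ∀ c ∈ t, c ∈ l := by
  induction n generalizing t with
  | zero => simp only [words, List.mem_singleton, List.length_eq_zero_iff]; aesop
  | succ n ih =>
    simp only [words, List.mem_flatMap, List.mem_map, ih]
    constructor
    · rintro ⟨t, ⟨rfl, ht⟩, c, hc, rfl⟩
      simpa using ⟨hc, ht⟩
    · cases t with
      | nil => simp
      | cons c t =>
        rintro ⟨h1, h2⟩
        exact ⟨t, ⟨by simpa using h1, fun c hc => h2 c (by simp [hc])⟩, c, h2 c (by simp), rfl⟩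

theorem primrec_words {α β : Type*} [Primcodable α] [Primcodable β] {f : β → List α} {g : β → ℕ}
    (hf : Primrec f) (hg : Primrec g) : Primrec fun b => words (f b) (g b) := by
  have hstep : Primrec₂ fun (b : β) (p : ℕ × List (List α)) =>
      p.2.flatMap fun t => (f b).map fun c => c :: t := by
    refine Primrec.list_flatMap (Primrec.snd.comp Primrec.snd) ?_
    refine Primrec.list_map (hf.comp (Primrec.fst.comp Primrec.fst)) ?_
    exact Primrec.list_cons.comp Primrec.snd (Primrec.snd.comp Primrec.fst)
  refine (Primrec.nat_rec' hg (Primrec.const [[]]) hstep).of_eq fun b => ?_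
  induction g b with
  | zero => rfl
  | succ n ih => simp only [words, ih]

theorem primrecPred_forall_mem {α β : Type*} [Primcodable α] [Primcodable β] {L : β → List α}
    {p : β → α → Prop} (hL : Primrec L) (hp : PrimrecRel p) :
    PrimrecPred fun b => ∀ a ∈ L b, p b a :=
  hp.swap.forall_mem_list.comp hL Primrec.id

theorem primrecPred_exists_mem {α β : Type*} [Primcodable α] [Primcodable β] {L : β → List α}
    {p : β → α → Prop} (hL : Primrec L) (hp : PrimrecRel p) :
    PrimrecPred fun b => ∃ a ∈ L b, p b a :=
  hp.swap.exists_mem_list.comp hL Primrec.id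

theorem primrec_pi {α σ : Type*} [Primcodable α] [Primcodable σ] {n : ℕ} {f : α → Fin n → σ}
    (h : ∀ j, Primrec fun a => f a j) : Primrec f :=
  Primrec.fin_curry.2 (Primrec.fin_curry₁.2 h).swap

/-- Unbounded search through the codes `n`, testing the at most one `b` that `n` decodes to. -/
theorem rePred_exists_of_primrecRel {α β : Type*} [Primcodable α] [Primcodable β]
    {p : α → β → Prop} (hp : PrimrecRel p) : REPred fun a => ∃ b, p a b := by
  classical
  have hq : PrimrecRel fun (a : α) (n : ℕ) =>
      ∃ b ∈ (Encodable.decode (α := β) n).toList, p a b :=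
    primrecPred_exists_mem (Primrec.optionToList.comp (Primrec.decode.comp Primrec.snd))
      (hp.comp₂ (Primrec.fst.comp₂ Primrec₂.left) Primrec₂.right)
  have hr : Partrec fun a : α => Nat.rfind fun n =>
      Part.some (decide (∃ b ∈ (Encodable.decode (α := β) n).toList, p a b)) :=
    Partrec.rfind hq.decide.to_comp.partrec
  refine hr.dom_re.of_eq fun a => ?_
  refine Nat.rfind_dom.trans ?_
  simp only [Part.mem_some_iff, Part.some_dom, implies_true, and_true, Option.mem_toList,
    true_eq_decide_iff]
  constructor
  · rintro ⟨n, b, -, hb⟩; exact ⟨b, hb⟩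
  · rintro ⟨b, hb⟩; exact ⟨Encodable.encode b, b, by simp, hb⟩

/-! ### Blocked words: refuting a tiling in a finite box -/

namespace LocalRule

/-- The code of a cell. -/
def cellCode {d : ℕ} (f : Fin d → ℕ) : ℕ := Encodable.encode (List.ofFn f)

theorem primrec_cellCode {d : ℕ} {α : Type*} [Primcodable α] {f : α → Fin d → ℕ}
    (hf : ∀ j, Primrec fun a => f a j) : Primrec fun a => cellCode (f a) :=
  Primrec.encode.comp (Primrec.list_ofFn hf)

theorem getD_ofFn {d : ℕ} (f : Fin d → ℕ) (j : Fin d) : (List.ofFn f).getD j 0 = f j := by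
  rw [List.getD_eq_getElem _ _ (by simp), List.getElem_ofFn]

/-- The window at position `l` of the finite table `t`, where coordinates are reduced by `red`. -/
def lookup {d : ℕ} {A Γ : Type*} (ρ : LocalRule d A Γ) (t : List A) (red : Fin d → ℕ → ℕ)
    (l : List ℕ) : Fin ρ.size → Option A :=
  fun i => t[cellCode fun j : Fin d => red j (l.getD j 0 + ρ.offset i j)]?

/-- The predicate `Q` holds for total windows. -/
def Defined {ι A Γ : Type*} (Q : (ι → A) → Γ → Prop) (w : ι → Option A) (c : Option Γ) : Prop :=
  ∃ w' c', (∀ i, w i = some (w' i)) ∧ c = some c' ∧ Q w' c'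

/-- A fixed relation on finitely many windows and letters is primitive recursive, however it was
obtained; only the lookup depends on the input. -/
theorem primrecPred_lookup {β A Γ : Type*} [Primcodable β] [Primcodable A] [Finite A]
    [Primcodable Γ] [Finite Γ] {d : ℕ} (ρ : LocalRule d A Γ)
    (Q : (Fin ρ.size → Option A) → Option Γ → Prop) {t : β → List A} {red : β → Fin d → ℕ → ℕ}
    {l : β → List ℕ} {s : β → Option Γ} (ht : Primrec t) (hred : ∀ j, Primrec₂ fun b => red b j)
    (hl : Primrec l) (hs : Primrec s) :
    PrimrecPred fun b => Q (ρ.lookup (t b) (red b) (l b)) (s b) := by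
  classical
  have hQ : PrimrecPred fun p : (Fin ρ.size → Option A) × Option Γ => Q p.1 p.2 :=
    (Primrec.dom_finite _).primrecPred
  refine hQ.comp (Primrec.pair (primrec_pi fun i => ?_) hs)
  refine Primrec.list_getElem?.comp ht (primrec_cellCode fun j => ?_)
  exact (hred j).comp Primrec.id
    (Primrec.nat_add.comp ((Primrec.list_getD 0).comp hl (Primrec.const _)) (Primrec.const _))

/-- No table of length `M` is compatible with the partial row `s` in the box of side `M`. -/
def Blocked {d a : ℕ} {Γ : Type*} (ρ : LocalRule d (Fin (a + 1)) Γ) (s : ℕ → Option Γ) (M : ℕ) :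
    Prop :=
  ∀ t ∈ words (List.finRange (a + 1)) M, ∃ l ∈ words (List.range M) d,
    Defined (fun w c => ¬ ρ.rel w c) (ρ.lookup t (fun _ m => m) l) (s (l.getD 0 0))

theorem primrecPred_blocked {β Γ : Type*} [Primcodable β] [Primcodable Γ] [Finite Γ] {d a : ℕ}
    (ρ : LocalRule d (Fin (a + 1)) Γ) {s : β → ℕ → Option Γ} {M : β → ℕ} (hs : Primrec₂ s)
    (hM : Primrec M) : PrimrecPred fun b => ρ.Blocked (s b) (M b) := by
  refine primrecPred_forall_mem (primrec_words (Primrec.const _) hM) ?_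
  refine primrecPred_exists_mem (β := β × List (Fin (a + 1)))
    (primrec_words (Primrec.list_range.comp (hM.comp Primrec.fst)) (Primrec.const _)) ?_
  exact ρ.primrecPred_lookup _ (Primrec.snd.comp Primrec.fst) (fun _ => Primrec₂.right) Primrec.snd
    (hs.comp (Primrec.fst.comp Primrec.fst)
      ((Primrec.list_getD 0).comp Primrec.snd (Primrec.const _)))

/-- The table of the values of `x` at the cells with codes less than `M`, translated by `h`
horizontally. -/
def table {k : ℕ} {A : Type*} (x : (Fin (k + 1) → ℤ) → A) (h : ℤ) (M : ℕ) : List A :=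
  (List.range M).map fun e => x fun j =>
    (((Encodable.decode (α := List ℕ) e).getD []).getD j 0 : ℤ) + if j = 0 then h else 0

theorem table_getElem? {k : ℕ} {A : Type*} (x : (Fin (k + 1) → ℤ) → A) (h : ℤ) (M : ℕ)
    (f : Fin (k + 1) → ℕ) : (table x h M)[cellCode f]? =
      if cellCode f < M then some (x fun j => (f j : ℤ) + if j = 0 then h else 0)
      else none := by
  split_ifs with hM
  · simp only [table, List.getElem?_map, List.getElem?_range hM, Option.map_some]
    simp only [cellCode, Encodable.encodek, Option.getD_some, getD_ofFn]
  · simp [table, not_lt.1 hM]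

theorem exists_cellCode_lt {d : ℕ} (B : ℕ) :
    ∃ M, ∀ f : Fin d → ℕ, (∀ j, f j ≤ B) → cellCode f < M := by
  obtain ⟨M, hM⟩ := ((Set.finite_Icc (0 : Fin d → ℕ) fun _ => B).image cellCode).bddAbove
  exact ⟨M + 1, fun f hf => Nat.lt_succ_of_le (hM ⟨f, ⟨fun j => Nat.zero_le _, hf⟩, rfl⟩)⟩

/-- The table read off a tiling, translated by `i`, violates nothing. Undefined letters or cells
never count as a violation, so `s` need only agree with `z` where it is defined. -/
theorem not_blocked_of_tiles {k a : ℕ} {Γ : Type*} {ρ : LocalRule (k + 1) (Fin (a + 1)) Γ}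
    {z : ℤ → Γ} (h : ∃ x, ρ.Tiles x fun v => z (v 0)) {s : ℕ → Option Γ} {i : ℤ}
    (hs : ∀ (j : ℕ) c, s j = some c → c = z (j + i)) (M : ℕ) : ¬ ρ.Blocked s M := by
  obtain ⟨x, hx⟩ := h
  intro hb
  obtain ⟨l, -, w, c, hw, hc, hrel⟩ := hb (table x i M) (mem_words.2 ⟨by simp [table], by simp⟩)
  refine hrel ?_
  have h1 := hx fun j => (l.getD j 0 : ℤ) + if j = 0 then i else 0
  rw [hs _ _ hc]
  convert h1 using 1
  · funext m
    have h2 := hw m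
    simp only [lookup, table_getElem?] at h2
    split_ifs at h2
    rw [← Option.some.inj h2]
    simp only [window]
    congr 1
    funext j
    push_cast; ring
  · simp

/-- For `M` large all windows based in the box of radius `N` have cell codes below `M`, so an
unblocked table tiles that box and compactness applies. The origin sits at `N`, which may exceed
`K`: the application to `^∞ u v w ^∞` needs a multiple of `u.length`. -/
theorem exists_tiles_of_not_blocked {k a : ℕ} {Γ : Type*}
    {ρ : LocalRule (k + 1) (Fin (a + 1)) Γ} {z : ℤ → Γ}
    (h : ∀ K : ℕ, ∃ N ≥ K, ∀ M₀ : ℕ, ∃ M ≥ M₀, ∃ s : ℕ → Option Γ,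
      (∀ j : ℕ, j < M → s j = some (z (j - (N : ℕ)))) ∧ ¬ ρ.Blocked s M) :
    ∃ x, ρ.Tiles x fun v => z (v 0) := by
  obtain ⟨r, hr⟩ := ρ.exists_offset_le
  refine exists_tiles_of_boxes fun K => ?_
  obtain ⟨N, hKN, hN⟩ := h K
  obtain ⟨B, hB⟩ := exists_cellCode_lt (d := k + 1) (2 * N + r)
  obtain ⟨M, hM, s, hs, hb⟩ := hN (max B (2 * N + 1))
  simp only [Blocked, not_forall, not_exists, not_and] at hb
  obtain ⟨t, ht, hb⟩ := hb
  rw [mem_words] at ht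
  -- The default `0` is harmless: every cell consulted from the box lies in the table.
  refine ⟨fun v => (t[cellCode fun j => (v j + N).toNat]?).getD 0, fun v hv => ?_⟩
  have hv' : ∀ j, 0 ≤ v j + N ∧ v j + N ≤ 2 * N := fun j => by
    have := abs_le.1 (hv j); omega
  let l : List ℕ := List.ofFn fun j => (v j + N).toNat
  have hl : ∀ j : Fin (k + 1), l.getD j 0 = (v j + N).toNat := getD_ofFn _
  have hl0 : l.getD 0 0 = (v 0 + N).toNat := hl 0
  have hlmem : l ∈ words (List.range M) (k + 1) := by
    refine mem_words.2 ⟨by simp [l], fun c hc => ?_⟩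
    obtain ⟨j, rfl⟩ := (List.mem_ofFn' _ _).1 hc
    have := hv' j
    simp only [List.mem_range]; omega
  by_contra hrel
  refine hb l hlmem ⟨_, z (v 0), fun i => ?_, ?_, hrel⟩
  · have hcell : (fun j : Fin (k + 1) => l.getD j 0 + ρ.offset i j) =
        fun j => (v j + ρ.offset i j + N).toNat := funext fun j => by
      have := hv' j
      rw [hl]; omega
    have hlt : cellCode (fun j : Fin (k + 1) => (v j + ρ.offset i j + N).toNat) <
        t.length := by
      rw [ht.1]
      refine (hB _ fun j => ?_).trans_le ((le_max_left _ _).trans hM)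
      have := hv' j
      have := hr i j
      omega
    simp only [lookup, hcell, window]
    rw [List.getElem?_eq_getElem hlt, Option.getD_some]
  · have := hv' 0
    rw [hl0, hs _ (by omega)]
    congr 2; omega

/-- The rows tiled by a rule are those that avoid the blocked words. -/
theorem exists_tiles_iff_forall_not_wordOccursAt {k a : ℕ} {Γ : Type*}
    {ρ : LocalRule (k + 1) (Fin (a + 1)) Γ} {z : ℤ → Γ} :
    (∃ x, ρ.Tiles x fun v => z (v 0)) ↔
      ∀ w : List Γ, ρ.Blocked (fun j => w[j]?) w.length → ∀ i, ¬ WordOccursAt w z i := by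
  constructor
  · intro h w hw i hocc
    refine not_blocked_of_tiles h (i := i) (fun j c hc => ?_) _ hw
    obtain ⟨hj, rfl⟩ := List.getElem?_eq_some_iff.1 hc
    rw [add_comm]
    exact (hocc j hj).symm
  · intro h
    refine exists_tiles_of_not_blocked fun K => ⟨K, le_rfl, fun M => ⟨M, le_rfl,
      fun j => ((List.range M).map fun j : ℕ => z (j - K))[j]?, fun j hj => by simp [hj],
        fun hb => ?_⟩⟩
    refine h ((List.range M).map fun j : ℕ => z (j - K)) (by simpa using hb) (-K) fun j hj => ?_
    simp only [List.getElem_map, List.getElem_range]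
    congr 1; ring

end LocalRule

/-! ### The letters of `^∞ u v w ^∞` and the folding of coordinates -/

theorem biInf_of_neg {Γ : Type*} {u v w : List Γ} (hu : u ≠ []) (hw : w ≠ []) {n : ℤ} (hn : n < 0) :
    some (biInf u v w hu hw n) = u[(n % u.length).toNat]? := by
  simp only [biInf, hn, if_true]
  rw [List.getElem?_eq_getElem]

theorem biInf_of_lt {Γ : Type*} {u v w : List Γ} (hu : u ≠ []) (hw : w ≠ []) {n : ℕ}
    (hn : n < v.length) : some (biInf u v w hu hw n) = v[n]? := by
  have h : ¬ ((n : ℤ) < 0) := by omega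
  simp only [biInf, h, if_false, Int.toNat_natCast, hn, dif_pos]
  rw [List.getElem?_eq_getElem]

theorem biInf_of_le {Γ : Type*} {u v w : List Γ} (hu : u ≠ []) (hw : w ≠ []) {n : ℤ}
    (hn : v.length ≤ n) :
    some (biInf u v w hu hw n) = w[((n - v.length) % w.length).toNat]? := by
  have h : ¬ n < 0 := by omega
  have h' : ¬ n.toNat < v.length := by omega
  simp only [biInf, h, h', if_false, dif_neg, not_false_eq_true]
  rw [List.getElem?_eq_getElem]

theorem biInf_eq_of_neg {Γ : Type*} {u v w : List Γ} (hu : u ≠ []) (hw : w ≠ []) {m n : ℤ}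
    (hm : m < 0) (hn : n < 0) (h : m ≡ n [ZMOD u.length]) :
    biInf u v w hu hw m = biInf u v w hu hw n := by
  rw [← Option.some_inj, biInf_of_neg hu hw hm, biInf_of_neg hu hw hn, h]

theorem biInf_eq_of_le {Γ : Type*} {u v w : List Γ} (hu : u ≠ []) (hw : w ≠ []) {m n : ℤ}
    (hm : v.length ≤ m) (hn : v.length ≤ n) (h : m ≡ n [ZMOD w.length]) :
    biInf u v w hu hw m = biInf u v w hu hw n := by
  rw [← Option.some_inj, biInf_of_le hu hw hm, biInf_of_le hu hw hn, h.sub_right]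

theorem biInf_map {Γ Δ : Type*} (f : Γ → Δ) {u v w : List Γ} (hu : u ≠ []) (hw : w ≠ [])
    (hu' : u.map f ≠ []) (hw' : w.map f ≠ []) :
    biInf (u.map f) (v.map f) (w.map f) hu' hw' = fun n => f (biInf u v w hu hw n) := by
  funext n
  rw [← Option.some_inj, ← Option.map_some (f := f)]
  rcases lt_or_ge n 0 with h | h
  · rw [biInf_of_neg _ _ h, biInf_of_neg _ _ h]; simp
  rcases lt_or_ge n v.length with h' | h'
  · lift n to ℕ using h
    rw [biInf_of_lt _ _ (by simpa using h'), biInf_of_lt _ _ (by exact_mod_cast h')]; simp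
  · rw [biInf_of_le _ _ (by simpa using h'), biInf_of_le _ _ h']; simp

/-- The letter of `^∞ u v w ^∞` at position `i - K * u.length`. -/
def letter {Γ : Type*} (u v w : List Γ) (K i : ℕ) : Option Γ :=
  if i < K * u.length then u[i % u.length]?
  else if i - K * u.length < v.length then v[i - K * u.length]?
  else w[(i - K * u.length - v.length) % w.length]?

theorem letter_eq {Γ : Type*} {u v w : List Γ} (hu : u ≠ []) (hw : w ≠ []) (K i : ℕ) :
    letter u v w K i = some (biInf u v w hu hw (i - (K * u.length : ℕ))) := by
  unfold letter
  split_ifs with h1 h2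
  · rw [biInf_of_neg _ _ (by omega)]
    push_cast
    rw [Int.sub_mul_emod_self_right]
    norm_cast
  · rw [← Nat.cast_sub (by omega), biInf_of_lt _ _ h2]
  · rw [← Nat.cast_sub (by omega), biInf_of_le _ _ (by omega), ← Nat.cast_sub (by omega)]
    norm_cast

theorem primrec_letter {Γ : Type*} [Primcodable Γ] :
    Primrec fun p : (List Γ × List Γ × List Γ) × ℕ × ℕ =>
      letter p.1.1 p.1.2.1 p.1.2.2 p.2.1 p.2.2 := by
  have hu : Primrec fun p : (List Γ × List Γ × List Γ) × ℕ × ℕ => p.1.1 :=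
    Primrec.fst.comp Primrec.fst
  have hv : Primrec fun p : (List Γ × List Γ × List Γ) × ℕ × ℕ => p.1.2.1 :=
    Primrec.fst.comp (Primrec.snd.comp Primrec.fst)
  have hw : Primrec fun p : (List Γ × List Γ × List Γ) × ℕ × ℕ => p.1.2.2 :=
    Primrec.snd.comp (Primrec.snd.comp Primrec.fst)
  have hK : Primrec fun p : (List Γ × List Γ × List Γ) × ℕ × ℕ => p.2.1 :=
    Primrec.fst.comp Primrec.snd
  have hi : Primrec fun p : (List Γ × List Γ × List Γ) × ℕ × ℕ => p.2.2 :=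
    Primrec.snd.comp Primrec.snd
  have hul := Primrec.list_length.comp hu
  have hvl := Primrec.list_length.comp hv
  have hwl := Primrec.list_length.comp hw
  have hKu := Primrec.nat_mul.comp hK hul
  have hd := Primrec.nat_sub.comp hi hKu
  exact Primrec.ite (Primrec.nat_lt.comp hi hKu)
    (Primrec.list_getElem?.comp hu (Primrec.nat_mod.comp hi hul))
    (Primrec.ite (Primrec.nat_lt.comp hd hvl) (Primrec.list_getElem?.comp hv hd)
      (Primrec.list_getElem?.comp hw (Primrec.nat_mod.comp (Primrec.nat_sub.comp hd hvl) hwl)))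

/-- The representative of a coordinate in a table that stands for a configuration with vertical
period `P` and horizontal period `P` outside of an interval; the horizontal origin is at `3 * P`. -/
def reduceCoord {k : ℕ} (P : ℕ) (j : Fin (k + 1)) (m : ℕ) : ℕ :=
  if j = 0 then if m ≤ 2 * P then m % P else if m < 4 * P then m else 4 * P + m % P else m % P

theorem primrec_reduceCoord {k : ℕ} (j : Fin (k + 1)) :
    Primrec₂ fun P m => reduceCoord P j m := by
  have hP : Primrec fun p : ℕ × ℕ => p.1 := Primrec.fst
  have hm : Primrec fun p : ℕ × ℕ => p.2 := Primrec.snd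
  have hmod := Primrec.nat_mod.comp hm hP
  have h4 := Primrec.nat_mul.comp (Primrec.const (α := ℕ × ℕ) 4) hP
  exact Primrec.ite (PrimrecPred.comp (p := fun _ : ℕ => j = 0)
      (Primrec.primrecPred (p := fun _ : ℕ => j = 0) (Primrec.const _)) hm)
    (Primrec.ite (Primrec.nat_le.comp hm (Primrec.nat_mul.comp (Primrec.const 2) hP)) hmod
      (Primrec.ite (Primrec.nat_lt.comp hm h4) hm (Primrec.nat_add.comp h4 hmod))) hmod

theorem reduceCoord_lt {k : ℕ} {P : ℕ} (hP : 0 < P) (j : Fin (k + 1)) (m : ℕ) :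
    reduceCoord P j m < 5 * P := by
  have := Nat.mod_lt m hP
  unfold reduceCoord
  split_ifs <;> omega

/-- The natural number that represents an integer coordinate. -/
def natCoord (P : ℕ) (n : ℤ) : ℕ := if 0 ≤ n then n.toNat else (n % P).toNat

theorem natCoord_mod {P : ℕ} (hP : 0 < P) (n : ℤ) : ((natCoord P n % P : ℕ) : ℤ) = n % P := by
  have h := Int.emod_nonneg n (b := P) (by omega)
  unfold natCoord
  split_ifs with h0
  · rw [Int.natCast_mod, Int.toNat_of_nonneg h0]
  · rw [Int.natCast_mod, Int.toNat_of_nonneg h, Int.emod_emod]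

theorem reduceCoord_natCoord_succ {k P : ℕ} (hP : 0 < P) {m n : ℤ} (h : m ≡ n [ZMOD P])
    (j : Fin k) : reduceCoord P j.succ (natCoord P m) = reduceCoord P j.succ (natCoord P n) := by
  simp only [reduceCoord, Fin.succ_ne_zero, if_false]
  zify
  have h1 := natCoord_mod hP m
  have h2 := natCoord_mod hP n
  push_cast at h1 h2
  rw [h1, h2, h]

/-- Below `2 * P` and from `4 * P` on, `reduceCoord` keeps only the zone and the residue. Negative
integers become residues below `P`, hence stay in the left zone. With the origin at `3 * P`, the
zones begin at distance `P` from it. -/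
theorem reduceCoord_natCoord_zero {k P : ℕ} (hP : 0 < P) {m n : ℤ} (h : m ≡ n [ZMOD P])
    (hmn : m ≤ 2 * P ∧ n ≤ 2 * P ∨ 4 * P ≤ m ∧ 4 * P ≤ n) :
    reduceCoord P (0 : Fin (k + 1)) (natCoord P m) =
      reduceCoord P (0 : Fin (k + 1)) (natCoord P n) := by
  have h1 := natCoord_mod hP m
  have h2 := natCoord_mod hP n
  have h3 : natCoord P m % P = natCoord P n % P := by
    zify; push_cast at h1 h2; rw [h1, h2, h]
  have hlt : ∀ n : ℤ, n % P < P := fun n => Int.emod_lt_of_pos n (by exact_mod_cast hP)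
  have hle : ∀ n : ℤ, n ≤ 2 * P → natCoord P n ≤ 2 * P := fun n hn => by
    have := hlt n
    unfold natCoord; split_ifs <;> omega
  have hge : ∀ n : ℤ, 4 * P ≤ n → 4 * P ≤ natCoord P n := fun n hn => by
    unfold natCoord; split_ifs <;> omega
  simp only [reduceCoord, if_true]
  rcases hmn with ⟨hm, hn⟩ | ⟨hm, hn⟩
  · rw [if_pos (hle m hm), if_pos (hle n hn), h3]
  · have := hge m hm
    have := hge n hn
    rw [if_neg (by omega), if_neg (by omega), if_neg (by omega), if_neg (by omega), h3]

/-! ### Finite certificates of eventually periodic tilings -/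

namespace LocalRule

/-- A configuration that is periodic outside of an interval tiles if it does so in a large box. -/
theorem tiles_of_periodic {k : ℕ} {A Γ : Type*} {ρ : LocalRule (k + 1) A Γ} {P : ℕ} (hP : 0 < P)
    (hr : ∀ i, ρ.offset i 0 ≤ P) {x : (Fin (k + 1) → ℤ) → A}
    (hx : ∀ v v', PeriodEquiv P P v v' → x v = x v') {z : ℤ → Γ}
    (hz : ∀ m n : ℤ, m ≡ n [ZMOD P] → (m < 0 ∧ n < 0 ∨ (P : ℤ) ≤ m ∧ (P : ℤ) ≤ n) → z m = z n)
    (h : ∀ v : Fin (k + 1) → ℤ, -(3 * P) ≤ v 0 → v 0 < 2 * P →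
      (∀ j : Fin k, 0 ≤ v j.succ ∧ v j.succ < P) → ρ.rel (ρ.window x v) (z (v 0))) :
    ρ.Tiles x fun v => z (v 0) := by
  intro v
  have hlt : ∀ n : ℤ, n % P < P := fun n => Int.emod_lt_of_pos n (by exact_mod_cast hP)
  have hnn : ∀ n : ℤ, 0 ≤ n % P := fun n => Int.emod_nonneg n (by omega)
  -- Left of `-(2 * P)` a window of width at most `P` remains at or below `-P`, so `v 0` moves to
  -- the period `[-3 * P, -2 * P)`; from `P` on it moves to `[P, 2 * P)`. This leaves a box of width
  -- `5 * P`.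
  obtain ⟨n, hn, hn1, hn2, hn3⟩ : ∃ n : ℤ, v 0 ≡ n [ZMOD P] ∧ -(3 * P) ≤ n ∧ n < 2 * P ∧
      (v 0 = n ∨ (v 0 < -(2 * P) ∧ n < -(2 * P)) ∨ ((P : ℤ) ≤ v 0 ∧ (P : ℤ) ≤ n)) := by
    have := hlt (v 0)
    have := hnn (v 0)
    have hmod : v 0 ≡ v 0 % P [ZMOD P] := (Int.mod_modEq _ _).symm
    rcases lt_or_ge (v 0) (-(2 * P)) with h1 | h1
    · refine ⟨v 0 % P + P * (-3), hmod.trans (Int.modEq_iff_dvd.2 ⟨-3, by ring⟩), ?_, ?_, ?_⟩ <;> omega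
    rcases lt_or_ge (v 0) P with h2 | h2
    · exact ⟨v 0, rfl, by omega, by omega, Or.inl rfl⟩
    · refine ⟨v 0 % P + P * 1, hmod.trans (Int.modEq_iff_dvd.2 ⟨1, by ring⟩), ?_, ?_, ?_⟩ <;> omega
  let v' : Fin (k + 1) → ℤ := Fin.cons n fun j => v j.succ % P
  have hw : ρ.window x v = ρ.window x v' := by
    funext i
    have := hr i
    refine hx _ _ ⟨fun j => ?_, ?_⟩
    · simp only [v', Fin.cons_succ]
      exact (Int.mod_modEq _ _).symm.add_right _
    · simp only [v', Fin.cons_zero]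
      rcases hn3 with h3 | h3
      · exact Or.inl (by rw [h3])
      · exact Or.inr ⟨hn.add_right _, by omega⟩
  have hz' : z (v 0) = z (v' 0) := by
    rcases hn3 with h3 | h3
    · simp only [v', Fin.cons_zero, h3]
    · exact hz _ _ hn (by simp only [v', Fin.cons_zero]; omega)
  simp only [hw, hz']
  exact h v' hn1 hn2 fun j => ⟨hnn _, hlt _⟩

/-- The pair `c` of a number and a table certifies that `^∞ u v w ^∞` is tiled, where `t` is the
triple `(u, v, w)` and `r` bounds the offsets of the rule. -/
def Certificate {k a : ℕ} {Γ : Type*} (ρ : LocalRule (k + 1) (Fin (a + 1)) Γ) (r : ℕ)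
    (t : List Γ × List Γ × List Γ) (c : ℕ × List (Fin (a + 1))) : Prop :=
  0 < c.1 * t.1.length * t.2.2.length ∧ t.2.1.length ≤ c.1 * t.1.length * t.2.2.length ∧
    r ≤ c.1 * t.1.length * t.2.2.length ∧
    ∀ l ∈ words (List.range (5 * (c.1 * t.1.length * t.2.2.length))) (k + 1),
      Defined ρ.rel (ρ.lookup c.2 (reduceCoord (c.1 * t.1.length * t.2.2.length)) l)
        (letter t.1 t.2.1 t.2.2 (3 * c.1 * t.2.2.length) (l.getD 0 0))

theorem primrecRel_certificate {k a : ℕ} {Γ : Type*} [Primcodable Γ] [Finite Γ]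
    (ρ : LocalRule (k + 1) (Fin (a + 1)) Γ) (r : ℕ) : PrimrecRel (ρ.Certificate r) := by
  have hc1 : Primrec fun p : (List Γ × List Γ × List Γ) × ℕ × List (Fin (a + 1)) => p.2.1 :=
    Primrec.fst.comp Primrec.snd
  have hw : Primrec fun p : (List Γ × List Γ × List Γ) × ℕ × List (Fin (a + 1)) =>
      p.1.2.2.length := Primrec.list_length.comp (Primrec.snd.comp (Primrec.snd.comp Primrec.fst))
  have hP : Primrec fun p : (List Γ × List Γ × List Γ) × ℕ × List (Fin (a + 1)) =>
      p.2.1 * p.1.1.length * p.1.2.2.length :=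
    Primrec.nat_mul.comp (Primrec.nat_mul.comp hc1
      (Primrec.list_length.comp (Primrec.fst.comp Primrec.fst))) hw
  refine (Primrec.nat_lt.comp (Primrec.const 0) hP).and ((Primrec.nat_le.comp
    (Primrec.list_length.comp (Primrec.fst.comp (Primrec.snd.comp Primrec.fst))) hP).and
      ((Primrec.nat_le.comp (Primrec.const r) hP).and ?_))
  refine primrecPred_forall_mem (primrec_words
    (Primrec.list_range.comp (Primrec.nat_mul.comp (Primrec.const 5) hP)) (Primrec.const _)) ?_
  refine ρ.primrecPred_lookup _ (Primrec.snd.comp (Primrec.snd.comp Primrec.fst))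
    (fun j => (primrec_reduceCoord j).comp (hP.comp (Primrec.fst.comp Primrec.fst)) Primrec.snd)
    Primrec.snd ?_
  refine primrec_letter.comp (Primrec.pair (Primrec.fst.comp Primrec.fst) (Primrec.pair ?_
    ((Primrec.list_getD 0).comp Primrec.snd (Primrec.const _))))
  exact Primrec.nat_mul.comp (Primrec.nat_mul.comp (Primrec.const 3) (hc1.comp Primrec.fst))
    (hw.comp Primrec.fst)

/-- Unfolding the table through `reduceCoord` builds the periods in, and the certificate checks
exactly the box to which `tiles_of_periodic` reduces all positions. -/
theorem exists_tiles_of_certificate {k a : ℕ} {Γ : Type*}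
    {ρ : LocalRule (k + 1) (Fin (a + 1)) Γ} {r : ℕ} (hr : ∀ i j, ρ.offset i j ≤ r)
    {u v w : List Γ} (hu : u ≠ []) (hw : w ≠ []) {c : ℕ × List (Fin (a + 1))}
    (h : ρ.Certificate r (u, v, w) c) : ∃ x, ρ.Tiles x fun p => biInf u v w hu hw (p 0) := by
  obtain ⟨g, t⟩ := c
  obtain ⟨hP, hv, hrP, hcert⟩ := h
  simp only at hP hv hrP hcert
  -- With `K = 3 * g * w.length`, the origin used by `letter` is at `3 * P`, as in `reduceCoord`.
  have hK : 3 * g * w.length * u.length = 3 * (g * u.length * w.length) := by ring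
  have huP : (u.length : ℤ) ∣ (g * u.length * w.length : ℕ) :=
    Int.natCast_dvd_natCast.2 ⟨g * w.length, by ring⟩
  have hwP : (w.length : ℤ) ∣ (g * u.length * w.length : ℕ) :=
    Int.natCast_dvd_natCast.2 ⟨g * u.length, by ring⟩
  have hlet := letter_eq (v := v) hu hw (3 * g * w.length)
  rw [hK] at hlet
  generalize g * u.length * w.length = P at *
  let cell : (Fin (k + 1) → ℤ) → Fin (k + 1) → ℕ := fun p j =>
    reduceCoord P j (natCoord P (p j + if j = 0 then (3 * P : ℤ) else 0))
  refine ⟨fun p => (t[cellCode (cell p)]?).getD 0, tiles_of_periodic hP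
    (fun i => (hr i 0).trans hrP) ?_ ?_ ?_⟩
  · rintro p p' ⟨hp, hp0⟩
    have : cell p = cell p' := by
      funext j
      refine Fin.cases ?_ (fun j => ?_) j
      · simp only [cell, if_true]
        rcases hp0 with hp0 | ⟨hp0, hp1⟩
        · rw [hp0]
        · exact reduceCoord_natCoord_zero hP (hp0.add_right _) (by omega)
      · simp only [cell, Fin.succ_ne_zero, if_false, add_zero]
        exact reduceCoord_natCoord_succ hP (hp j) j
    simp only [this]
  · rintro m n hmn (⟨h1, h2⟩ | ⟨h1, h2⟩)
    · exact biInf_eq_of_neg hu hw h1 h2 (hmn.of_dvd huP)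
    · exact biInf_eq_of_le hu hw (by omega) (by omega) (hmn.of_dvd hwP)
  · intro p hp1 hp2 hp
    let l : List ℕ := List.ofFn fun j => (p j + if j = 0 then (3 * P : ℤ) else 0).toNat
    have hl : ∀ j : Fin (k + 1), l.getD j 0 = (p j + if j = 0 then (3 * P : ℤ) else 0).toNat :=
      getD_ofFn _
    have hl0 : l.getD 0 0 = (p 0 + 3 * P).toNat := hl 0
    have hnn : ∀ j : Fin (k + 1), 0 ≤ p j + (if j = 0 then (3 * P : ℤ) else 0) ∧
        p j + (if j = 0 then (3 * P : ℤ) else 0) < 5 * P := by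
      refine Fin.cases ?_ fun j => ?_
      · simp only [if_true]; omega
      · have := hp j
        simp only [Fin.succ_ne_zero, if_false]; omega
    obtain ⟨w', c, hw', hc, hrel⟩ := hcert l (mem_words.2 ⟨by simp [l], fun c hc => by
      obtain ⟨j, rfl⟩ := (List.mem_ofFn' _ _).1 hc
      have := hnn j
      simp only [List.mem_range]; omega⟩)
    rw [hl0, hlet, Option.some_inj] at hc
    convert hrel using 1
    · funext i
      have h1 := hw' i
      have hcell : (fun j : Fin (k + 1) => reduceCoord P j (l.getD j 0 + ρ.offset i j)) =
          cell fun j => p j + ρ.offset i j := by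
        funext j
        have := hnn j
        simp only [cell]
        congr 1
        rw [hl, natCoord]
        generalize (if j = 0 then (3 * P : ℤ) else 0) = q at this ⊢
        rw [if_pos (by omega)]
        omega
      simp only [lookup, hcell] at h1
      simp only [window, h1, Option.getD_some]
    · rw [← hc]
      congr 1
      omega

/-- Countability enters through `exists_eventuallyPeriodic`: the table records one period of such a
tiling on each side together with the part between. -/
theorem exists_certificate_of_tiles {k a : ℕ} {Γ : Type*}
    {ρ : LocalRule (k + 1) (Fin (a + 1)) Γ} (hρ : ρ.cover.Countable) (r : ℕ)
    {u v w : List Γ} (hu : u ≠ []) (hw : w ≠ [])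
    (h : ∃ x, ρ.Tiles x fun p => biInf u v w hu hw (p 0)) : ∃ c, ρ.Certificate r (u, v, w) c := by
  obtain ⟨x, hx, P₀, hP₀, N, hper⟩ := exists_eventuallyPeriodic hρ h
  have hu' := List.length_pos_of_ne_nil hu
  have hw' := List.length_pos_of_ne_nil hw
  -- This makes `P = g * u.length * w.length` a multiple of `P₀` that exceeds `N`, `r` and
  -- `v.length`; the `+ 1` keeps it positive.
  let g := P₀ * (N + r + v.length + 1)
  have hK : 3 * g * w.length * u.length = 3 * (g * u.length * w.length) := by ring
  have hlarge : N + r + v.length + 1 ≤ g * u.length * w.length := by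
    calc N + r + v.length + 1 ≤ g := Nat.le_mul_of_pos_left _ hP₀
      _ ≤ g * u.length := Nat.le_mul_of_pos_right _ hu'
      _ ≤ g * u.length * w.length := Nat.le_mul_of_pos_right _ hw'
  have hdvd : (P₀ : ℤ) ∣ (g * u.length * w.length : ℕ) :=
    Int.natCast_dvd_natCast.2 ⟨(N + r + v.length + 1) * u.length * w.length, by
      simp only [g]; ring⟩
  have hlet := letter_eq (v := v) hu hw (3 * g * w.length)
  rw [hK] at hlet
  obtain ⟨M, hM⟩ := exists_cellCode_lt (d := k + 1) (5 * (g * u.length * w.length))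
  refine ⟨(g, table x (-(3 * (g * u.length * w.length : ℕ))) M), ?_⟩
  simp only [Certificate]
  generalize g * u.length * w.length = P at *
  have hP : 0 < P := by omega
  refine ⟨hP, by omega, by omega, fun l _ => ⟨_, _, fun i => ?_, hlet _, hx fun j =>
    (l.getD j 0 : ℤ) + if j = 0 then -(3 * P : ℤ) else 0⟩⟩
  · simp only [lookup, table_getElem?]
    rw [if_pos (hM _ fun j => (reduceCoord_lt hP _ _).le)]
    simp only [window, Option.some_inj]
    refine hper _ _ ⟨fun j => ?_, ?_⟩
    · simp only [reduceCoord, Fin.succ_ne_zero, if_false, add_zero]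
      push_cast
      exact (Int.mod_modEq _ _).of_dvd hdvd
    · simp only [reduceCoord, if_true]
      generalize l.getD ((0 : Fin (k + 1)) : ℕ) 0 = b
      generalize ρ.offset i 0 = b'
      -- Folding preserves the residue modulo `P₀`; `q = 0` serves the left zone and `q = 4` the
      -- right one, whose representatives start at `4 * P`.
      have hmod : ∀ q : ℤ, (((b + b') % P : ℕ) : ℤ) + P * q - 3 * P ≡ b + -(3 * P) + b' [ZMOD P₀] := by
        intro q
        refine Int.ModEq.of_dvd hdvd ?_
        have h1 : (((b + b') % P : ℕ) : ℤ) ≡ ((b + b' : ℕ) : ℤ) [ZMOD P] := by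
          rw [Int.natCast_mod]; exact Int.mod_modEq _ _
        have h2 : (P : ℤ) * q ≡ 0 [ZMOD P] := (Int.modEq_zero_iff_dvd).2 ⟨q, rfl⟩
        convert (h1.add h2).sub_right (3 * P : ℤ) using 1
        push_cast; ring
      have := Nat.mod_lt (b + b') hP
      split_ifs with h1 h2
      · refine Or.inr ⟨?_, Or.inr (by omega)⟩
        convert hmod 0 using 1
        push_cast; ring
      · exact Or.inl (by push_cast; ring)
      · refine Or.inr ⟨?_, Or.inl (by omega)⟩
        convert hmod 4 using 1
        push_cast; ring

end LocalRule

/-! ### The three conditions for the rows -/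

namespace LocalRule

/-- The rule with the letters of `Γ` renamed. -/
def relabel {d : ℕ} {A Γ Δ : Type*} (ρ : LocalRule d A Γ) (e : Δ → Γ) : LocalRule d A Δ :=
  { size := ρ.size
    offset := ρ.offset
    rel := fun w c => ρ.rel w (e c) }

theorem cover_relabel {d : ℕ} {A Γ Δ : Type*} (ρ : LocalRule d A Γ) (e : Δ → Γ) :
    (ρ.relabel e).cover ⊆ ρ.cover := by
  rintro x ⟨y, hy⟩
  exact ⟨fun v => e (y v), hy⟩

end LocalRule

/-- A configuration whose periods include all vertical directions is determined by its row. -/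
theorem eq_row_of_isVerticallyConstant {Γ : Type*} [TopologicalSpace Γ] {k : ℕ}
    {Y : Subshift Γ (Fin (k + 1) → ℤ)} (hY : IsVerticallyConstant Y)
    {y : (Fin (k + 1) → ℤ) → Γ} (hy : y ∈ Y.carrier) : y = fun v => row y (v 0) := by
  let H : AddSubgroup (Fin (k + 1) → ℤ) :=
    { carrier := {g | shift g y = y}
      zero_mem' := shift_zero y
      add_mem' := fun {g g'} hg hg' => by
        simp only [Set.mem_ofPred_eq] at hg hg' ⊢
        rw [shift_add, hg, hg']
      neg_mem' := fun {g} hg => by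
        simp only [Set.mem_ofPred_eq] at hg ⊢
        nth_rw 1 [← hg]
        rw [← shift_add, add_neg_cancel, shift_zero] }
  funext v
  have hmem : v - rowPoint (k + 1) (v 0) ∈ H := by
    rw [← Finset.univ_sum_single (v - rowPoint (k + 1) (v 0))]
    refine H.sum_mem fun i _ => ?_
    rcases Nat.eq_zero_or_pos (i : ℕ) with hi | hi
    · have : i = 0 := Fin.ext hi
      subst this
      simp only [Pi.sub_apply, rowPoint, Fin.val_zero, if_true, sub_self, Pi.single_zero]
      exact H.zero_mem
    · have h1 : Pi.single i (1 : ℤ) ∈ H := hY y hy i hi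
      have h2 : ∀ c : ℤ, Pi.single i c = c • (Pi.single i 1 : Fin (k + 1) → ℤ) := fun c => by
        rw [← Pi.single_smul, smul_eq_mul, mul_one]
      rw [h2]
      exact H.zsmul_mem h1 _
  have h : shift (v - rowPoint (k + 1) (v 0)) y = y := hmem
  have := congrFun h (rowPoint (k + 1) (v 0))
  simpa [row] using this

theorem mem_projSub_iff {Γ : Type*} [Finite Γ] [TopologicalSpace Γ] [DiscreteTopology Γ] {k : ℕ}
    {Y : Subshift Γ (Fin (k + 1) → ℤ)} (hY : IsVerticallyConstant Y) {A : Type*}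
    {ρ : LocalRule (k + 1) A Γ} (hρ : ∀ y, y ∈ Y.carrier ↔ ∃ x, ρ.Tiles x y) {z : ℤ → Γ} :
    z ∈ (projSub Y).carrier ↔ ∃ x, ρ.Tiles x fun v => z (v 0) := by
  rw [← hρ]
  constructor
  · rintro ⟨y, hy, rfl⟩
    rw [← eq_row_of_isVerticallyConstant hY hy]
    exact hy
  · intro h
    exact ⟨_, h, by funext n; simp [row, rowPoint]⟩

/-- The forbidden words are the blocked ones, read in the numbering `e`. -/
theorem isEffectivelyClosed_of_tiles {Γ : Type*} [Finite Γ] [TopologicalSpace Γ]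
    {Z : Subshift Γ ℤ} {k a : ℕ} {ρ : LocalRule (k + 1) (Fin (a + 1)) Γ}
    (hZ : ∀ z, z ∈ Z.carrier ↔ ∃ x, ρ.Tiles x fun v => z (v 0)) : IsEffectivelyClosed Z := by
  intro n e
  refine ⟨{w | (ρ.relabel e.symm).Blocked (fun j => w[j]?) w.length},
    (((ρ.relabel e.symm).primrecPred_blocked Primrec.list_getElem?
      Primrec.list_length).computablePred).to_re, ?_⟩
  ext x
  have hx : x ∈ Z.carrier ↔
      ∃ x', (ρ.relabel e.symm).Tiles x' fun v => (fun i => e (x i)) (v 0) := by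
    rw [hZ]
    simp only [LocalRule.Tiles, LocalRule.relabel, Equiv.symm_apply_apply]
    rfl
  refine (hx.trans
    (LocalRule.exists_tiles_iff_forall_not_wordOccursAt (z := fun i => e (x i)))).trans ?_
  refine forall_congr' fun w => forall_congr' fun _ => forall_congr' fun i => not_congr ?_
  simp [WordOccursAt, Equiv.eq_symm_apply]

/-- Post's theorem: certificates enumerate the members, and blocked boxes enumerate the rest. -/
theorem biInfDecidable_of_tiles {Γ : Type*} [Finite Γ] [TopologicalSpace Γ]
    {Z : Subshift Γ ℤ} {k a : ℕ} {ρ : LocalRule (k + 1) (Fin (a + 1)) Γ} (hc : ρ.cover.Countable)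
    (hZ : ∀ z, z ∈ Z.carrier ↔ ∃ x, ρ.Tiles x fun v => z (v 0)) : BiInfDecidable Z := by
  intro n e
  let ρ' := ρ.relabel e.symm
  obtain ⟨r, hr⟩ := ρ'.exists_offset_le
  have hc' : ρ'.cover.Countable := hc.mono (ρ.cover_relabel _)
  have hmem : ∀ (u v w : List (Fin n)), BiInfMem Z (u.map e.symm) (v.map e.symm) (w.map e.symm) ↔
      ∃ (hu : u ≠ []) (_ : v ≠ []) (hw : w ≠ []),
        ∃ x, ρ'.Tiles x fun p => biInf u v w hu hw (p 0) := by
    intro u v w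
    have key : ∀ (hu : u ≠ []) (hw : w ≠ []) (hu' : u.map e.symm ≠ []) (hw' : w.map e.symm ≠ []),
        biInf (u.map e.symm) (v.map e.symm) (w.map e.symm) hu' hw' ∈ Z.carrier ↔
          ∃ x, ρ'.Tiles x fun p => biInf u v w hu hw (p 0) := by
      intro hu hw hu' hw'
      rw [biInf_map _ hu hw, hZ]
      rfl
    constructor
    · rintro ⟨hu', hv', hw', h⟩
      have hu : u ≠ [] := by simpa using hu'
      have hw : w ≠ [] := by simpa using hw'
      exact ⟨hu, by simpa using hv', hw, (key hu hw hu' hw').1 h⟩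
    · rintro ⟨hu, hv, hw, h⟩
      have hu' : u.map e.symm ≠ [] := by simpa using hu
      have hw' : w.map e.symm ≠ [] := by simpa using hw
      exact ⟨hu', by simpa using hv, hw', (key hu hw hu' hw').2 h⟩
  have hu : Primrec fun t : List (Fin n) × List (Fin n) × List (Fin n) => t.1 := Primrec.fst
  have hv : Primrec fun t : List (Fin n) × List (Fin n) × List (Fin n) => t.2.1 :=
    Primrec.fst.comp Primrec.snd
  have hw : Primrec fun t : List (Fin n) × List (Fin n) × List (Fin n) => t.2.2 :=
    Primrec.snd.comp Primrec.snd
  rw [ComputablePred.computable_iff_re_compl_re']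
  constructor
  -- Positivity of the period in a certificate already excludes empty `u` and `w`; only `v` needs a
  -- separate test.
  · have hp : PrimrecRel fun (t : List (Fin n) × List (Fin n) × List (Fin n))
        (c : ℕ × List (Fin (a + 1))) => t.2.1 ≠ [] ∧ ρ'.Certificate r t c :=
      ((Primrec.eq.comp hv (Primrec.const [])).not.comp Primrec.fst).and
        (ρ'.primrecRel_certificate r)
    refine (rePred_exists_of_primrecRel hp).of_eq ?_
    rintro ⟨u, v, w⟩
    rw [hmem]
    constructor
    · rintro ⟨c, hv, hcert⟩
      have hpos := hcert.1
      have hu : u ≠ [] := by rintro rfl; simp at hpos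
      have hw : w ≠ [] := by rintro rfl; simp at hpos
      exact ⟨hu, hv, hw, LocalRule.exists_tiles_of_certificate hr hu hw hcert⟩
    · rintro ⟨hu, hv, hw, h⟩
      obtain ⟨c, hcert⟩ := LocalRule.exists_certificate_of_tiles hc' r hu hw h
      exact ⟨c, hv, hcert⟩
  -- The search runs over pairs: the origin is at `c.1 * u.length` and the box has side `c.2`.
  -- Triples with an empty word are rejected outright.
  · have hp : PrimrecRel fun (t : List (Fin n) × List (Fin n) × List (Fin n)) (c : ℕ × ℕ) =>
        t.1 = [] ∨ t.2.1 = [] ∨ t.2.2 = [] ∨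
          ρ'.Blocked (fun i => letter t.1 t.2.1 t.2.2 c.1 i) c.2 := by
      refine ((Primrec.eq.comp hu (Primrec.const [])).comp Primrec.fst).or
        (((Primrec.eq.comp hv (Primrec.const [])).comp Primrec.fst).or
          (((Primrec.eq.comp hw (Primrec.const [])).comp Primrec.fst).or
            (ρ'.primrecPred_blocked ?_ (Primrec.snd.comp Primrec.snd))))
      exact primrec_letter.comp (Primrec.pair (Primrec.fst.comp Primrec.fst)
        (Primrec.pair (Primrec.fst.comp (Primrec.snd.comp Primrec.fst)) Primrec.snd))
    refine (rePred_exists_of_primrecRel hp).of_eq ?_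
    rintro ⟨u, v, w⟩
    rw [hmem]
    constructor
    · rintro ⟨⟨K, M⟩, h⟩ ⟨hu, hv, hw, hx⟩
      rcases h with h | h | h | h
      · exact hu h
      · exact hv h
      · exact hw h
      · refine LocalRule.not_blocked_of_tiles hx (i := -(K * u.length : ℕ)) (fun j c hc => ?_) M h
        rw [letter_eq hu hw, Option.some_inj] at hc
        rw [← hc, sub_eq_add_neg]
    · intro h
      by_contra hno
      simp only [not_exists, not_or] at hno
      obtain ⟨hu, hv, hw, -⟩ := hno (0, 0)
      refine h ⟨hu, hv, hw, LocalRule.exists_tiles_of_not_blocked fun K =>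
        ⟨K * u.length, Nat.le_mul_of_pos_right _ (List.length_pos_of_ne_nil hu), fun M =>
          ⟨M, le_rfl, letter u v w K, fun j _ => letter_eq hu hw K j, (hno (K, M)).2.2.2⟩⟩⟩

end CountableCover

theorem mainTheorem2 {Γ : Type*} [Finite Γ] [TopologicalSpace Γ] [DiscreteTopology Γ]
    (d : ℕ) (hd : 2 ≤ d) (Y : Subshift Γ (Fin d → ℤ))
    (hvert : CountableCover.IsVerticallyConstant Y)
    (hcov : CountableCover.IsCountablyCovered Y) :
    CountableCover.CountableCoverConditions Y := by
  obtain ⟨k, rfl⟩ : ∃ k, d = k + 1 := ⟨d - 1, by omega⟩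
  obtain ⟨a, ρ, hfun, hcount, hρ⟩ := hcov.exists_localRule
  have hmem : ∀ z, z ∈ (CountableCover.projSub Y).carrier ↔ ∃ x, ρ.Tiles x fun v => z (v 0) :=
    fun z => CountableCover.mem_projSub_iff hvert hρ
  exact ⟨hvert, CountableCover.isEffectivelyClosed_of_tiles hmem,
    fun z hz => CountableCover.LocalRule.ultPeriodic_of_tiles hfun hcount ((hmem z).1 hz),
    CountableCover.biInfDecidable_of_tiles hcount hmem⟩
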